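/- **Setting.** Let $W:[0,1]^2\to[0,1]$ be a graphon (a symmetric measurable function). Let $X=(X_i)_{i\ge 1}$ be independent random variables, uniform on $[0,1]$, and for each $n\ge1$ let $G_n$ be the $W$-random graph on $[n]=\{1,\dots,n\}$: given $X$, each pair $\{i,j\}$ with $i\neq j$ in $[n]$ is an edge of $G_n$ with probability $W(X_i,X_j)$, independently for all pairs. Let $d\ge 1$, let $F=(F_1,\dots,F_d)$ be simple graphs with common vertex set $[p]$, and let $\ell=\ell_1\cdots\ell_k$ ($1\le k\le p$) be a word of pairwise distinct elements of $[p]$; write $q\in\ell$ if $q$ is one of the $\ell_i$. Assume that for all $m,m'\in[d]$ and $i,i'\in\ell$: $\{i,i'\}\in E(F_m)\iff\{i,i'\}\in E(F_{m'})$. **Notation.** For $n\ge k$ let $\mathcal S_{n,k}$ be the set of words $\alpha=\alpha_1\cdots\alpha_k$ of pairwise distinct elements of $[n]$. For a graph $G$ on $[n]$ with $n\ge p$ and $\alpha\in\mathcal S_{n,k}$ let $$t_{\mathrm{inj}}(F_m^\ell,G^\alpha)=\frac{(n-p)!}{(n-k)!}\,\bigl|\{\varphi:F_m\to G \text{ injective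 homomorphism},\ \varphi(\ell_i)=\alpha_i\ \forall i\in[k]\}\bigr| .$$ For a simple graph $H$ on $[p]$, a word $\lambda=\lambda_1\cdots\lambda_r$ of distinct elements of $[p]$ and $x\in[0,1]^r$ put $$\hat t_x(H^\lambda,W)=\prod_{\{i,j\}\subset[r]:\ \{\lambda_i,\lambda_j\}\in E(H)}W(x_i,x_j),\qquad \tilde t_x(H^\lambda,W)=\int \prod_{\{a,b\}\in E(H),\ \{a,b\}\not\subset\lambda}W(y_a,y_b)\prod_{a\in[p]\setminus\lambda}dy_a,$$ where in the last integral $y_{\lambda_i}=x_i$ for $i\in[r]$ and the other $y_a$ range over $[0,1]$; put $t_x(H^\lambda,W)=\hat t_x(H^\lambda,W)\,\tilde t_x(H^\lambda,W)$. Write $\tilde t_x(F^\ell,W)=(\tilde t_x(F_m^\ell,W))_{m\in[d]}$ and similarly for $t_x$ and $t_{\mathrm{inj}}$; by the assumption $\hat t_x(F_m^\ell,W)$ does not depend on $m$ and is written $\hat t_x(F^\ell,W)$. For $g:[0,1]^d\to\mathbb R$ set (for $n\ge p$) $$\Gamma_n^{F,\ell}(g)=\frac1{|\mathcal S_{n,k}|}\sum_{\alpha\in\mathcal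 S_{n,k}}g\bigl(t_{\mathrm{inj}}(F^\ell,G_n^\alpha)\bigr),$$ $$\Gamma^{F,\ell}(g)=\int_{[0,1]^k}\hat t_x(F^\ell,W)\,g\bigl(\tilde t_x(F^\ell,W)\bigr)dx+\Bigl(1-\int_{[0,1]^k}\hat t_x(F^\ell,W)\,dx\Bigr)g(0).$$ **Theorem 3.2.** For every $g\in C^2([0,1]^d)$, $$\sqrt n\,\bigl(\Gamma_n^{F,\ell}(g)-\Gamma^{F,\ell}(g)\bigr)\ \longrightarrow\ \mathcal N\bigl(0,\sigma^{F,\ell}(g)^2\bigr)\quad\text{in distribution as } n\to\infty,$$ where $\sigma^{F,\ell}(g)^2=\mathrm{Var}(\mathcal U_g^{F,\ell})$ and, with $U$ uniform on $[0,1]$, $$\mathcal U_g^{F,\ell}=\sum_{i=1}^k\int_{[0,1]^k}\hat t_{R_i(x,U)}(F^\ell,W)\Bigl(g\bigl(\tilde t_{R_i(x,U)}(F^\ell,W)\bigr)-g(0)\Bigr)dx+\sum_{q\in[p],\,q\notin\ell}\int_{[0,1]^k}\bigl\langle t_{xU}(F^{\ell q},W),\nabla g\bigl(\tilde t_x(F^\ell,W)\bigr)\bigr\rangle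 dx .$$ Here $R_i(x,U)$ is $x$ with its $i$-th coordinate replaced by $U$, $xU=(x_1,\dots,x_k,U)$ and $\ell q=\ell_1\cdots\ell_k q$. (When $\sigma^{F,\ell}(g)=0$, $\mathcal N(0,0)$ is the Dirac mass at $0$.) -/

import Mathlib

open MeasureTheory ProbabilityTheory Filter
open scoped unitInterval

noncomputable section

namespace GraphonCLT

/-- A graphon: a symmetric measurable function `[0,1]² → [0,1]`. -/
structure Graphon where
  toFun : I → I → I
  symm : ∀ x y, toFun x y = toFun y x
  measurable : Measurable (Function.uncurry toFun)

/-- For an unordered pair `e = {i, j}`, the number `W (x i) (x j)`. -/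
def Graphon.edgeVal {V : Type*} (W : Graphon) (x : V → I) (e : Sym2 V) : ℝ :=
  Sym2.lift ⟨fun i j => (W.toFun (x i) (x j) : ℝ), fun i j => by simp only [W.symm (x i)]⟩ e

/-! ### Finite graphs

Words `ℓ = ℓ₁ … ℓₖ` over `[p]` are functions `Fin k → Fin p`; the word has distinct characters iff
the function is injective. Vertices are numbered from `0`. -/

/-- The density of injective homomorphisms `F → G` sending the labelled vertices `ℓ i` of `F` to
the vertices `α i` of `G`: `|Inj(F^ℓ, G^α)| / A_{n-k}^{p-k}`. -/
def tInj {k p n : ℕ} (F : SimpleGraph (Fin p)) (ℓ : Fin k → Fin p)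
    (G : SimpleGraph (Fin n)) (α : Fin k → Fin n) : ℝ :=
  (Nat.card {φ : F →g G // Function.Injective φ ∧ ∀ i, φ (ℓ i) = α i} : ℝ) /
    ((n - k).descFactorial (p - k) : ℝ)

/-- `Γ_n^{F,ℓ}(g)` for a given graph `G` on `n` vertices: the average of `g (tInj (F^ℓ, G^α))` over
all words `α` of length `k` over `[n]` with distinct characters. -/
def gammaN {d k p n : ℕ} (F : Fin d → SimpleGraph (Fin p)) (ℓ : Fin k → Fin p)
    (g : (Fin d → ℝ) → ℝ) (G : SimpleGraph (Fin n)) : ℝ :=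
  (∑ α : Fin k ↪ Fin n, g (fun m => tInj (F m) ℓ G α)) / (Fintype.card (Fin k ↪ Fin n) : ℝ)

/-! ### Homomorphism densities in a graphon -/

open Classical in
/-- The product of `W (x i) (x j)` over the pairs `{i, j}` of
positions in `ℓ` for which `{ℓ i, ℓ j}` is an edge of `F`. -/
def tHat {k p : ℕ} (F : SimpleGraph (Fin p)) (ℓ : Fin k → Fin p) (W : Graphon)
    (x : Fin k → I) : ℝ :=
  ∏ e : Sym2 (Fin k) with e ∈ (F.comap ℓ).edgeSet, W.edgeVal x e

open Classical in
/-- The product of `W (y i) (y j)` over the edges `{i, j}` of `F` that do not have both ends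
labelled. -/
def zTilde {k p : ℕ} (F : SimpleGraph (Fin p)) (ℓ : Fin k → Fin p) (W : Graphon)
    (y : Fin p → I) : ℝ :=
  ∏ e : Sym2 (Fin p) with e ∈ F.edgeSet ∧ ¬ ∀ v ∈ e, v ∈ Set.range ℓ, W.edgeVal y e

/-- `zTilde` averaged over the unlabelled coordinates, the labelled ones being fixed to `y_ℓ = x`:
`Function.extend ℓ x y` is `y` with its coordinate `ℓ i` replaced by `x i` for every `i` (the
replaced coordinates of `y` are integrated against a probability measure, with no effect). -/
def tTilde {k p : ℕ} (F : SimpleGraph (Fin p)) (ℓ : Fin k → Fin p) (W : Graphon)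
    (x : Fin k → I) : ℝ :=
  ∫ y : Fin p → I, zTilde F ℓ W (Function.extend ℓ x y)

/-- The labelled homomorphism density `t_x(F^ℓ, W)`. -/
def tLab {k p : ℕ} (F : SimpleGraph (Fin p)) (ℓ : Fin k → Fin p) (W : Graphon)
    (x : Fin k → I) : ℝ :=
  tHat F ℓ W x * tTilde F ℓ W x

/-- All the graphs `F m` have the same edges between labelled vertices. -/
def SameLabelledEdges {d k p : ℕ} (F : Fin d → SimpleGraph (Fin p)) (ℓ : Fin k → Fin p) : Prop :=
  ∀ m m' : Fin d, ∀ i i' : Fin k, (F m).Adj (ℓ i) (ℓ i') ↔ (F m').Adj (ℓ i) (ℓ i')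

/-- The vector `(t̃_x(F_m^ℓ, W))_m`. -/
def tTildeVec {d k p : ℕ} (F : Fin d → SimpleGraph (Fin p)) (ℓ : Fin k → Fin p) (W : Graphon)
    (x : Fin k → I) : Fin d → ℝ :=
  fun m => tTilde (F m) ℓ W x

/-- `Γ^{F,ℓ}(g)`. Under `SameLabelledEdges F ℓ` the function `tHat (F m) ℓ W` does not depend on
`m`, and its common value is taken at `m = 0`. -/
def gammaLim {d k p : ℕ} [NeZero d] (F : Fin d → SimpleGraph (Fin p)) (ℓ : Fin k → Fin p)
    (W : Graphon) (g : (Fin d → ℝ) → ℝ) : ℝ :=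
  (∫ x : Fin k → I, tHat (F 0) ℓ W x * g (tTildeVec F ℓ W x)) +
    (1 - ∫ x : Fin k → I, tHat (F 0) ℓ W x) * g 0

/-- The cube `[0,1]^d`. -/
def cube (d : ℕ) : Set (Fin d → ℝ) := Set.Icc 0 1

/-- The gradient `∇g(z)` of a function on `[0,1]^d` (one-sided derivatives at the boundary). -/
def gradCube {d : ℕ} (g : (Fin d → ℝ) → ℝ) (z : Fin d → ℝ) : Fin d → ℝ :=
  fun m => fderivWithin ℝ g (cube d) z (Pi.single m 1)

open Classical in
/-- The value at `U = u` of the variable `𝒰_g^{F,ℓ}`. Here `Function.update x i u` is the word `x`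
with its `i`-th character replaced by `u`, and `Fin.snoc x u`, `Fin.snoc ℓ q` are the words `xu`
and `ℓq`. -/
def uVar {d k p : ℕ} [NeZero d] (F : Fin d → SimpleGraph (Fin p)) (ℓ : Fin k → Fin p)
    (W : Graphon) (g : (Fin d → ℝ) → ℝ) (u : I) : ℝ :=
  (∑ i : Fin k, ∫ x : Fin k → I, tHat (F 0) ℓ W (Function.update x i u) *
      (g (tTildeVec F ℓ W (Function.update x i u)) - g 0)) +
    ∑ q : Fin p with q ∉ Set.range ℓ, ∫ x : Fin k → I,
      ∑ m : Fin d, tLab (F m) (Fin.snoc ℓ q : Fin (k + 1) → Fin p) W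
        (Fin.snoc x u : Fin (k + 1) → I) * gradCube g (tTildeVec F ℓ W x) m

/-! ### `W`-random graphs -/

open Classical in
/-- `(G n)` are `W`-random graphs, `G n` having vertex set `[n]`, constructed from `X`: the `X i` are
independent and uniform on `[0,1]`, and given `X` the pairs `{i, j}` with `i ≠ j` are edges of `G n`
independently of one another, with probabilities `W (X i) (X j)`; that is, the conditional
probability that `G n` is a given graph `H` is a product over the pairs. -/
structure IsWRandomGraph {Ω : Type*} [MeasurableSpace Ω] (W : Graphon) (P : Measure Ω)
    (X : ℕ → Ω → I) (G : (n : ℕ) → Ω → SimpleGraph (Fin n)) : Prop where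
  measurable_X : ∀ i, Measurable (X i)
  uniform_X : ∀ i, P.map (X i) = volume
  indep_X : iIndepFun X P
  measurable_G : ∀ n, ∀ i j : Fin n, MeasurableSet {ω | (G n ω).Adj i j}
  cond_prob : ∀ n, ∀ H : SimpleGraph (Fin n),
    P[Set.indicator {ω | G n ω = H} (fun _ => (1 : ℝ)) |
        MeasurableSpace.comap (fun ω i => X i ω) MeasurableSpace.pi] =ᵐ[P]
      fun ω => ∏ e : Sym2 (Fin n) with ¬ e.IsDiag,
        if e ∈ H.edgeSet then W.edgeVal (fun i : Fin n => X i ω) e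
        else 1 - W.edgeVal (fun i : Fin n => X i ω) e

end GraphonCLT

end

namespace GraphonCLT

/-! Fix a word `α` and let `Y` be the indicator that the labelled edges of `F` are present at `α`.
Given the labels of `α` and the edges inside `α`, each extension of `α` to a copy of `[p]`
contributes conditional mean `Y * tTilde` to `tInj`, and two extensions are correlated only if they
meet outside `α`, which is a proportion `O(1/n)` of the pairs. So `tInj` lies within `O(1/n)` of `Y
* tTilde` in mean square (`exists_integral_sq_tInj_sub_le`). As `g` is `C²` on a compact cube,
replacing it by its first-order Taylor polynomial at `Y * tTilde` costs a quadratic error, of mean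
`O(1/n)`, negligible at scale `n^(-1/2)` (`exists_integral_abs_gammaN_sub_le`).

Because `Y` is 0 or 1 and `tInj` vanishes with it, the linearization is a combination of products of
edge indicators with coefficients depending on the labels. Averaged over `α` it becomes a
U-statistic of order `p` in labels and edges, with kernel `linKernel`.

Such a statistic is treated by Hájek projection. Subtract from the kernel its mean and its centred
conditional means given one label. Copies with at most one common vertex share no edge, so edge
indicators may be replaced by values of `W`, and the remainders at such copies are orthogonal. Only
pairs of copies with two common vertices contribute, and the remainder has second moment `O(n^(-2))`
(`EdgeKernel.exists_integral_sq_average_sub_le`). In particular the randomness of the edges is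
invisible at scale `n^(-1/2)`.

What survives is an average of i.i.d. centred functions of the `X i`. The mean of `linKernel` is
`gammaLim` (`integral_linKernel_mean`), and the sum of its projections is `uVar` up to a constant:
labelled vertices give the first sum in `uVar`, unlabelled ones the gradient sum
(`exists_sum_linKernel_proj_eq`). The classical central limit theorem and Slutsky's lemma finish the
proof. -/

/-- Bounded measurable real functions. -/
structure BddMeas {α : Type*} [MeasurableSpace α] (f : α → ℝ) : Prop where
  measurable : Measurable f
  bdd : ∃ C, ∀ x, |f x| ≤ C

/-! ### Closure properties of bounded measurable functions. -/

namespace BddMeas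

variable {α β : Type*} [MeasurableSpace α] [MeasurableSpace β]

lemma const (c : ℝ) : BddMeas (fun _ : α => c) := ⟨measurable_const, |c|, fun _ => le_rfl⟩

lemma add {f g : α → ℝ} (hf : BddMeas f) (hg : BddMeas g) : BddMeas (fun x => f x + g x) := by
  obtain ⟨C, hC⟩ := hf.bdd
  obtain ⟨D, hD⟩ := hg.bdd
  exact ⟨hf.measurable.add hg.measurable, C + D, fun x =>
    (abs_add_le _ _).trans (add_le_add (hC x) (hD x))⟩

lemma mul {f g : α → ℝ} (hf : BddMeas f) (hg : BddMeas g) : BddMeas (fun x => f x * g x) := by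
  obtain ⟨C, hC⟩ := hf.bdd
  obtain ⟨D, hD⟩ := hg.bdd
  refine ⟨hf.measurable.mul hg.measurable, C * D, fun x => ?_⟩
  rw [abs_mul]
  exact mul_le_mul (hC x) (hD x) (abs_nonneg _) ((abs_nonneg _).trans (hC x))

lemma neg {f : α → ℝ} (hf : BddMeas f) : BddMeas (fun x => -f x) := by
  obtain ⟨C, hC⟩ := hf.bdd
  exact ⟨hf.measurable.neg, C, fun x => by simpa using hC x⟩

lemma sub {f g : α → ℝ} (hf : BddMeas f) (hg : BddMeas g) : BddMeas (fun x => f x - g x) := by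
  simpa only [sub_eq_add_neg] using hf.add hg.neg

lemma sum {ι : Type*} {f : ι → α → ℝ} (s : Finset ι) (hf : ∀ i ∈ s, BddMeas (f i)) :
    BddMeas (fun x => ∑ i ∈ s, f i x) := by
  classical
  induction s using Finset.induction_on with
  | empty => simpa using const 0
  | insert a s ha ih =>
    simp only [Finset.sum_insert ha]
    exact (hf a (by simp)).add (ih fun i hi => hf i (by simp [hi]))

lemma prod {ι : Type*} {f : ι → α → ℝ} (s : Finset ι) (hf : ∀ i ∈ s, BddMeas (f i)) :
    BddMeas (fun x => ∏ i ∈ s, f i x) := by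
  classical
  induction s using Finset.induction_on with
  | empty => simpa using const 1
  | insert a s ha ih =>
    simp only [Finset.prod_insert ha]
    exact (hf a (by simp)).mul (ih fun i hi => hf i (by simp [hi]))

lemma sq {f : α → ℝ} (hf : BddMeas f) : BddMeas (fun x => f x ^ 2) := by
  simpa only [_root_.sq] using hf.mul hf

lemma abs {f : α → ℝ} (hf : BddMeas f) : BddMeas (fun x => |f x|) := by
  obtain ⟨C, hC⟩ := hf.bdd
  exact ⟨hf.measurable.abs, C, fun x => by simpa using hC x⟩

lemma comp {f : α → ℝ} (hf : BddMeas f) {g : β → α} (hg : Measurable g) :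
    BddMeas (fun x => f (g x)) := by
  obtain ⟨C, hC⟩ := hf.bdd
  exact ⟨hf.measurable.comp hg, C, fun x => hC _⟩

lemma integrable {f : α → ℝ} (hf : BddMeas f) (μ : Measure α) [IsFiniteMeasure μ] :
    Integrable f μ := by
  obtain ⟨C, hC⟩ := hf.bdd
  exact .of_bound hf.measurable.aestronglyMeasurable C (.of_forall hC)

lemma memLp {f : α → ℝ} (hf : BddMeas f) (μ : Measure α) [IsFiniteMeasure μ] (q : ENNReal) :
    MemLp f q μ := by
  obtain ⟨C, hC⟩ := hf.bdd
  exact .of_bound hf.measurable.aestronglyMeasurable C (.of_forall hC)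

lemma integral_right {f : α × β → ℝ} (hf : BddMeas f) (μ : Measure β) [IsProbabilityMeasure μ] :
    BddMeas (fun x => ∫ y, f (x, y) ∂μ) := by
  obtain ⟨C, hC⟩ := hf.bdd
  refine ⟨(hf.measurable.stronglyMeasurable.integral_prod_right' (ν := μ)).measurable, C,
    fun x => ?_⟩
  simpa using norm_integral_le_of_norm_le_const (μ := μ) (f := fun y => f (x, y)) (C := C)
    (.of_forall fun y => hC _)

lemma abs_integral_le {f : α → ℝ} {C : ℝ} (hC : ∀ x, |f x| ≤ C) (μ : Measure α)
    [IsProbabilityMeasure μ] : |∫ x, f x ∂μ| ≤ C := by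
  simpa using norm_integral_le_of_norm_le_const (μ := μ) (f := f) (C := C) (.of_forall hC)

end BddMeas

/-! ### Integration over cubes: fixing and relabelling coordinates. -/

section Pi

variable {ι κ : Type*} [Fintype ι] [Fintype κ]

lemma measurable_extend {ι κ : Type*} (f : ι → κ) :
    Measurable (fun z : (ι → I) × (κ → I) => Function.extend f z.1 z.2) := by
  classical
  refine measurable_pi_lambda _ fun j => ?_
  by_cases h : ∃ i, f i = j
  · simp only [Function.extend_def, h, dite_true]
    fun_prop
  · simp only [Function.extend_def, h, dite_false]
    fun_prop

/-- Checked on boxes: the preimage of a box is a product of two boxes, the second being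
unconstrained in the overwritten coordinates. This allows fixing the labels of some vertices first
and integrating over the others afterwards. -/
lemma measurePreserving_extend {f : ι → κ} (hf : Function.Injective f) :
    MeasurePreserving (fun z : (ι → I) × (κ → I) => Function.extend f z.1 z.2)
      (volume.prod volume) volume := by
  classical
  refine ⟨measurable_extend f, ?_⟩
  refine (Measure.pi_eq fun s hs => ?_).symm
  rw [Measure.map_apply (measurable_extend f) (.univ_pi hs)]
  have : (fun z : (ι → I) × (κ → I) => Function.extend f z.1 z.2) ⁻¹' (Set.univ.pi s) =
      (Set.univ.pi fun i => s (f i)) ×ˢ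
        (Set.univ.pi fun j => if j ∈ Set.range f then Set.univ else s j) := by
    ext ⟨x, y⟩
    simp only [Set.mem_preimage, Set.mem_pi, Set.mem_univ, true_imp_iff, Set.mem_prod]
    constructor
    · intro h
      refine ⟨fun i => by simpa [hf.extend_apply] using h (f i), fun j => ?_⟩
      split_ifs with hj
      · trivial
      · simpa [Function.extend_apply' _ _ _ hj] using h j
    · rintro ⟨h₁, h₂⟩ j
      by_cases hj : j ∈ Set.range f
      · obtain ⟨i, rfl⟩ := hj
        simpa [hf.extend_apply] using h₁ i
      · rw [Function.extend_apply' _ _ _ hj]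
        simpa only [if_neg hj] using h₂ j
  rw [this, Measure.prod_prod, volume_pi, volume_pi, Measure.pi_pi, Measure.pi_pi,
    ← Finset.prod_image (s := Finset.univ) (g := f) (f := fun j => volume (s j)) hf.injOn,
    ← Finset.prod_mul_prod_compl (Finset.univ.image f) fun j => volume (s j)]
  congr 1
  rw [← Finset.prod_mul_prod_compl (Finset.univ.image f), Finset.prod_eq_one, one_mul]
  · refine Finset.prod_congr rfl fun j hj => ?_
    rw [if_neg (by simpa using hj)]
  · intro j hj
    rw [if_pos (by simpa using hj)]
    simp

lemma measurePreserving_precomp {f : ι → κ} (hf : Function.Injective f) :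
    MeasurePreserving (fun x : κ → I => fun i => x (f i)) volume volume := by
  refine ⟨by fun_prop, ?_⟩
  have h : iIndepFun (fun (j : κ) (x : κ → I) => x j) volume :=
    iIndepFun_pi (X := fun (_ : κ) (x : I) => x) fun _ => aemeasurable_id
  rw [(h.precomp hf).map_fun_eq_pi_map fun i => (measurable_pi_apply _).aemeasurable]
  congr 1
  ext1 i
  exact (measurePreserving_eval (fun _ : κ => (volume : Measure I)) (f i)).map_eq

lemma integral_precomp {f : ι → κ} (hf : Function.Injective f) {φ : (ι → I) → ℝ}
    (hφ : BddMeas φ) : ∫ x : κ → I, φ (fun i => x (f i)) = ∫ x, φ x := by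
  rw [← (measurePreserving_precomp (κ := κ) hf).map_eq,
    integral_map (measurePreserving_precomp hf).measurable.aemeasurable
    hφ.measurable.aestronglyMeasurable]

lemma integral_extend {f : ι → κ} (hf : Function.Injective f) {φ : (κ → I) → ℝ}
    (hφ : BddMeas φ) : ∫ x, φ x = ∫ x : ι → I, ∫ y : κ → I, φ (Function.extend f x y) := by
  conv_lhs => rw [← (measurePreserving_extend hf).map_eq,
    integral_map (measurePreserving_extend hf).measurable.aemeasurable
    hφ.measurable.aestronglyMeasurable]
  exact integral_prod _ ((hφ.comp (measurable_extend f)).integrable _)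

lemma integral_eval (j : κ) {φ : I → ℝ} (hφ : BddMeas φ) : ∫ x : κ → I, φ (x j) = ∫ u, φ u := by
  have h := measurePreserving_eval (fun _ : κ => (volume : Measure I)) j
  rw [← h.map_eq, integral_map h.measurable.aemeasurable hφ.measurable.aestronglyMeasurable]
  rfl

lemma integral_update [DecidableEq κ] (q : κ) {φ : (κ → I) → ℝ} (hφ : BddMeas φ) :
    ∫ x, φ x = ∫ u : I, ∫ y : κ → I, φ (Function.update y q u) := by
  have hinj : Function.Injective (fun _ : Unit => q) := fun _ _ _ => rfl
  rw [integral_extend hinj hφ]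
  have : ∀ (x : Unit → I) (y : κ → I),
      Function.extend (fun _ : Unit => q) x y = Function.update y q (x ()) := by
    intro x y
    ext1 j
    by_cases h : j = q
    · subst h
      simpa using hinj.extend_apply x y ()
    · rw [Function.update_of_ne h, Function.extend_apply']
      rintro ⟨_, h'⟩
      exact h h'.symm
  simp_rw [this]
  refine integral_eval () (φ := fun u => ∫ y : κ → I, φ (Function.update y q u)) ?_
  refine BddMeas.integral_right (f := fun z : I × (κ → I) => φ (Function.update z.2 q z.1)) ?_ _
  refine hφ.comp (measurable_pi_lambda _ fun j => ?_)
  by_cases h : j = q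
  · subst h; simpa using measurable_fst
  · simp only [Function.update_of_ne h]
    fun_prop

end Pi

/-! ### Moments of edge indicators in a `W`-random graph. -/

open Classical in
/-- The indicator of `e` being an edge of `H`. -/
noncomputable def edgeInd {V : Type*} (H : SimpleGraph V) (e : Sym2 V) : ℝ :=
  if e ∈ H.edgeSet then 1 else 0

lemma edgeVal_map {V V' : Type*} (W : Graphon) (f : V → V') (x : V' → I) (e : Sym2 V) :
    W.edgeVal x (e.map f) = W.edgeVal (fun i => x (f i)) e := by
  induction e with | _ a b => rfl

lemma edgeVal_mem_Icc {V : Type*} (W : Graphon) (x : V → I) (e : Sym2 V) :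
    W.edgeVal x e ∈ Set.Icc (0 : ℝ) 1 := by
  induction e with | _ a b => exact (W.toFun (x a) (x b)).2

lemma BddMeas.edgeVal {V : Type*} (W : Graphon) (e : Sym2 V) :
    BddMeas (fun x : V → I => W.edgeVal x e) := by
  refine ⟨?_, 1, fun x => ?_⟩
  · induction e with | _ a b =>
    have : Measurable (fun x : V → I => Function.uncurry W.toFun (x a, x b)) :=
      W.measurable.comp (by fun_prop)
    exact measurable_subtype_coe.comp this
  · obtain ⟨h0, h1⟩ := edgeVal_mem_Icc W x e
    rwa [abs_of_nonneg h0]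

/-- Expanding the product over all pairs: under independent edges with probabilities `a e`, the
probability that all elements of `S` are edges is the product of their probabilities. -/
lemma sum_graph_prod {V : Type*} [Fintype V] [DecidableEq V] (a : Sym2 V → ℝ)
    (S : Finset (Sym2 V)) (hS : ∀ e ∈ S, ¬ e.IsDiag) [DecidablePred fun e : Sym2 V => ¬ e.IsDiag]
    [∀ (H : SimpleGraph V) (e : Sym2 V), Decidable (e ∈ H.edgeSet)] :
    ∑ H : SimpleGraph V, (∏ e ∈ S, edgeInd H e) *
      (∏ e : Sym2 V with ¬ e.IsDiag, if e ∈ H.edgeSet then a e else 1 - a e) =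
      ∏ e ∈ S, a e := by
  classical
  set D : Finset (Sym2 V) := Finset.univ.filter fun e => ¬ e.IsDiag with hD
  have hSD : S ⊆ D := fun e he => by simp [hD, hS e he]
  -- Pairs outside `S` contribute a factor `a e + (1 - a e) = 1`. Expanding the product over `D`
  -- gives a sum over subsets of `D`, that is, over graphs.
  have h1 : ∏ e ∈ S, a e = ∏ e ∈ D, (a e + if e ∈ S then 0 else 1 - a e) := by
    rw [← Finset.prod_subset hSD (f := fun e => a e + if e ∈ S then 0 else 1 - a e)]
    · exact Finset.prod_congr rfl fun e he => by simp [he]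
    · intro e _ he
      simp [he]
  rw [h1, Finset.prod_add]
  refine Finset.sum_bij' (fun H _ => D.filter (· ∈ H.edgeSet))
    (fun T _ => SimpleGraph.fromEdgeSet (T : Set (Sym2 V))) ?_ ?_ ?_ ?_ ?_
  · intro H _
    simp
  · intro T _
    simp
  · intro H _
    ext v w
    simp only [hD, SimpleGraph.fromEdgeSet_adj, Finset.coe_filter, Finset.mem_filter,
      Finset.mem_univ, true_and, Set.mem_ofPred_eq, SimpleGraph.mem_edgeSet, Sym2.mk_isDiag_iff]
    exact ⟨fun h => h.1.2, fun h => ⟨⟨h.ne, h⟩, h.ne⟩⟩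
  · intro T hT
    rw [Finset.mem_powerset] at hT
    ext e
    have hTD : e ∈ T → ¬ e.IsDiag := fun h => by simpa [hD] using hT h
    simp only [hD, Finset.mem_filter, Finset.mem_univ, true_and, SimpleGraph.edgeSet_fromEdgeSet,
      Set.mem_sdiff, Finset.mem_coe]
    exact ⟨fun h => h.2.1, fun h => ⟨hTD h, h, hTD h⟩⟩
  · intro H _
    have h4 : ∏ e ∈ S, edgeInd H e = ∏ e ∈ D, if e ∈ S then edgeInd H e else 1 := by
      rw [Finset.prod_ite_mem, Finset.inter_eq_right.2 hSD]
    rw [← Finset.prod_filter_mul_prod_filter_not D (· ∈ H.edgeSet)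
      (fun e => if e ∈ H.edgeSet then a e else 1 - a e),
      h4]
    have h2 : D \ D.filter (· ∈ H.edgeSet) = D.filter (¬ · ∈ H.edgeSet) := by
      ext e; simp; tauto
    rw [h2, ← Finset.prod_filter_mul_prod_filter_not D (· ∈ H.edgeSet)
      (fun e => if e ∈ S then edgeInd H e else 1)]
    have h3 : ∏ e ∈ D with e ∈ H.edgeSet, (if e ∈ S then edgeInd H e else 1) = 1 := by
      refine Finset.prod_eq_one fun e he => ?_
      simp [edgeInd, (Finset.mem_filter.1 he).2]
    rw [h3, one_mul, mul_left_comm, ← Finset.prod_mul_distrib]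
    congr 1
    · refine Finset.prod_congr rfl fun e he => ?_
      simp [(Finset.mem_filter.1 he).2]
    · refine Finset.prod_congr rfl fun e he => ?_
      by_cases h : e ∈ S <;> simp [edgeInd, (Finset.mem_filter.1 he).2, h]

lemma integral_mul_eq_of_condExp_ae_eq {Ω : Type*} {m mΩ : MeasurableSpace Ω} {P : Measure Ω}
    [IsFiniteMeasure P] (hm : m ≤ mΩ) {f h w : Ω → ℝ} (hf : StronglyMeasurable[m] f)
    (hfh : Integrable (fun ω => f ω * h ω) P) (hh : Integrable h P) (hw : P[h | m] =ᵐ[P] w) :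
    ∫ ω, f ω * h ω ∂P = ∫ ω, f ω * w ω ∂P := by
  rw [← integral_condExp hm]
  refine integral_congr_ae ?_
  filter_upwards [condExp_mul_of_stronglyMeasurable_left (μ := P) hf hfh hh, hw] with ω h1 h2
  exact h1.trans (by rw [Pi.mul_apply, h2])

namespace IsWRandomGraph

variable {Ω : Type*} [MeasurableSpace Ω] {P : Measure Ω}
  {W : Graphon} {X : ℕ → Ω → I} {G : (n : ℕ) → Ω → SimpleGraph (Fin n)}
  (hG : IsWRandomGraph W P X G)

include hG

lemma measurableSet_eq (n : ℕ) (H : SimpleGraph (Fin n)) : MeasurableSet {ω | G n ω = H} := by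
  have : {ω | G n ω = H} = ⋂ i, ⋂ j, {ω | (G n ω).Adj i j ↔ H.Adj i j} := by
    ext ω
    simp only [Set.mem_ofPred_eq, Set.mem_iInter]
    exact ⟨fun h => by simp [h], fun h => by ext i j; exact h i j⟩
  rw [this]
  refine .iInter fun i => .iInter fun j => ?_
  by_cases h : H.Adj i j
  · simpa [h] using hG.measurable_G n i j
  · simp only [h, iff_false]
    exact (hG.measurable_G n i j).compl

lemma bddMeas_graph {n : ℕ} (f : SimpleGraph (Fin n) → ℝ) : BddMeas (fun ω => f (G n ω)) := by
  classical
  have : (fun ω => f (G n ω)) = fun ω => ∑ H : SimpleGraph (Fin n),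
      f H * Set.indicator {ω | G n ω = H} (fun _ => (1 : ℝ)) ω := by
    ext ω
    rw [Finset.sum_eq_single (G n ω)]
    · simp
    · intro H _ h
      simp [h.symm]
    · simp
  rw [this]
  refine BddMeas.sum _ fun H _ => (BddMeas.const _).mul
    ⟨measurable_const.indicator (hG.measurableSet_eq n H), 1, fun ω => ?_⟩
  by_cases h : G n ω = H <;> simp [h]

lemma bddMeas_X {n : ℕ} {φ : (Fin n → I) → ℝ} (hφ : BddMeas φ) :
    BddMeas (fun ω => φ (fun i => X i ω)) :=
  hφ.comp (measurable_pi_lambda _ fun i => hG.measurable_X i)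

lemma measurePreserving_X (n : ℕ) :
    MeasurePreserving (fun ω (i : Fin n) => X i ω) P volume := by
  refine ⟨measurable_pi_lambda _ fun i => hG.measurable_X i, ?_⟩
  rw [(hG.indep_X.precomp (g := fun i : Fin n => (i : ℕ)) Fin.val_injective).map_fun_eq_pi_map
    fun i => (hG.measurable_X _).aemeasurable]
  congr 1
  ext1 i
  exact hG.uniform_X i

lemma integral_X {n : ℕ} {φ : (Fin n → I) → ℝ} (hφ : BddMeas φ) :
    ∫ ω, φ (fun i => X i ω) ∂P = ∫ x, φ x := by
  rw [← (hG.measurePreserving_X n).map_eq,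
    integral_map (hG.measurePreserving_X n).measurable.aemeasurable
    hφ.measurable.aestronglyMeasurable]

/-- The conditional law `cond_prob` enters here: a function of the first `n` labels is measurable
for the σ-algebra of `X` and can be pulled out of the conditional expectation. -/
lemma integral_mul_graph_eq [IsProbabilityMeasure P] {n : ℕ} {φ : (Fin n → I) → ℝ} (hφ : BddMeas φ)
    (H : SimpleGraph (Fin n)) [DecidablePred fun e : Sym2 (Fin n) => ¬ e.IsDiag]
    [∀ e : Sym2 (Fin n), Decidable (e ∈ H.edgeSet)] :
    ∫ ω, φ (fun i => X i ω) * Set.indicator {ω | G n ω = H} (fun _ => (1 : ℝ)) ω ∂P =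
      ∫ ω, φ (fun i => X i ω) * (∏ e : Sym2 (Fin n) with ¬ e.IsDiag,
        if e ∈ H.edgeSet then W.edgeVal (fun i : Fin n => X i ω) e
        else 1 - W.edgeVal (fun i : Fin n => X i ω) e) ∂P := by
  have hle : MeasurableSpace.comap (fun ω i => X i ω) MeasurableSpace.pi ≤ ‹MeasurableSpace Ω› :=
    (measurable_pi_lambda _ fun i => hG.measurable_X i).comap_le
  have hXm : Measurable[MeasurableSpace.comap (fun ω i => X i ω) MeasurableSpace.pi]
      (fun ω (i : Fin n) => X i ω) :=
    (measurable_pi_lambda (fun (x : ℕ → I) (i : Fin n) => x i)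
      fun i => measurable_pi_apply _).comp (comap_measurable _)
  have hind : BddMeas (Set.indicator {ω | G n ω = H} (fun _ => (1 : ℝ))) := by
    refine ⟨measurable_const.indicator (hG.measurableSet_eq n H), 1, fun ω => ?_⟩
    by_cases h : G n ω = H <;> simp [h]
  refine integral_mul_eq_of_condExp_ae_eq hle (hφ.measurable.comp hXm).stronglyMeasurable
    (((hG.bddMeas_X hφ).mul hind).integrable P) (hind.integrable P) ?_
  filter_upwards [hG.cond_prob n H] with ω h
  rw [h]
  congr!

/-- Given `X`, the elements of a set `S` of pairs are all edges of `G n` with conditional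
probability the product of the `W (X i) (X j)`. -/
lemma integral_mul_prod_edgeInd [IsProbabilityMeasure P] {n : ℕ} {φ : (Fin n → I) → ℝ} (hφ : BddMeas φ)
    (S : Finset (Sym2 (Fin n))) (hS : ∀ e ∈ S, ¬ e.IsDiag) :
    ∫ ω, φ (fun i => X i ω) * ∏ e ∈ S, edgeInd (G n ω) e ∂P =
      ∫ x, φ x * ∏ e ∈ S, W.edgeVal x e := by
  classical
  rw [← hG.integral_X (hφ.mul (BddMeas.prod S fun e _ => BddMeas.edgeVal W e))]
  have h1 : ∀ ω, φ (fun i => X i ω) * ∏ e ∈ S, edgeInd (G n ω) e =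
      ∑ H : SimpleGraph (Fin n), (∏ e ∈ S, edgeInd H e) *
        (φ (fun i => X i ω) * Set.indicator {ω | G n ω = H} (fun _ => (1 : ℝ)) ω) := by
    intro ω
    rw [Finset.sum_eq_single (G n ω)]
    · simp [mul_comm]
    · intro H _ h
      simp [h.symm]
    · simp
  have hw : ∀ H : SimpleGraph (Fin n), BddMeas (fun ω => ∏ e : Sym2 (Fin n) with ¬ e.IsDiag,
        if e ∈ H.edgeSet then W.edgeVal (fun i : Fin n => X i ω) e
        else 1 - W.edgeVal (fun i : Fin n => X i ω) e) := by
    intro H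
    refine BddMeas.prod _ fun e _ => ?_
    have := hG.bddMeas_X (BddMeas.edgeVal W e)
    split_ifs
    · exact this
    · exact (BddMeas.const 1).sub this
  simp_rw [h1]
  rw [integral_finsetSum]
  · simp_rw [integral_const_mul, hG.integral_mul_graph_eq hφ, ← integral_const_mul]
    rw [← integral_finsetSum]
    · refine integral_congr_ae (.of_forall fun ω => ?_)
      dsimp only
      rw [← sum_graph_prod (W.edgeVal fun i : Fin n => X i ω) S hS, Finset.mul_sum]
      refine Finset.sum_congr rfl fun H _ => ?_
      ring
    · intro H _
      exact (((hG.bddMeas_X hφ).mul (hw H)).integrable P).const_mul _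
  · intro H _
    refine (((hG.bddMeas_X hφ).mul ?_).integrable P).const_mul _
    refine ⟨measurable_const.indicator (hG.measurableSet_eq n H), 1, fun ω => ?_⟩
    by_cases h : G n ω = H <;> simp [h]

/-- By `hAB` no pair of vertices occurs twice among the images, so the two products form one product
over a set of distinct pairs. -/
lemma integral_mul_prod_two [IsProbabilityMeasure P] {n p : ℕ} {φ : (Fin n → I) → ℝ} (hφ : BddMeas φ)
    (γ γ' : Fin p ↪ Fin n) (A B : Finset (Sym2 (Fin p)))
    (hA : ∀ e ∈ A, ¬ e.IsDiag) (hB : ∀ e ∈ B, ¬ e.IsDiag)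
    (hAB : ∀ e ∈ A, ∀ e' ∈ B, e.map γ ≠ e'.map γ') :
    ∫ ω, φ (fun i => X i ω) * ((∏ e ∈ A, edgeInd (G n ω) (e.map γ)) *
      ∏ e ∈ B, edgeInd (G n ω) (e.map γ')) ∂P =
      ∫ x, φ x * ((∏ e ∈ A, W.edgeVal (fun i => x (γ i)) e) *
        ∏ e ∈ B, W.edgeVal (fun i => x (γ' i)) e) := by
  classical
  have hdisj : Disjoint (A.image (Sym2.map γ)) (B.image (Sym2.map γ')) := by
    rw [Finset.disjoint_left]
    intro e h1 h2
    obtain ⟨a, ha, rfl⟩ := Finset.mem_image.1 h1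
    obtain ⟨b, hb, h⟩ := Finset.mem_image.1 h2
    exact hAB a ha b hb h.symm
  have key := hG.integral_mul_prod_edgeInd hφ (A.image (Sym2.map γ) ∪ B.image (Sym2.map γ')) (by
    intro e he
    rcases Finset.mem_union.1 he with h | h
    · obtain ⟨a, ha, rfl⟩ := Finset.mem_image.1 h
      rw [Sym2.isDiag_map γ.injective]
      exact hA a ha
    · obtain ⟨a, ha, rfl⟩ := Finset.mem_image.1 h
      rw [Sym2.isDiag_map γ'.injective]
      exact hB a ha)
  simp only [Finset.prod_union hdisj, Finset.prod_image (Sym2.map.injective γ.injective).injOn,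
    Finset.prod_image (Sym2.map.injective γ'.injective).injOn, edgeVal_map] at key
  exact key

end IsWRandomGraph

/-! ### Counting embeddings, and a second moment bound for averages. -/

/-- What remains to be chosen is an embedding of the complement of the range of `ℓ` into the
complement of the range of `α`. -/
lemma card_embedding_extending {ι κ V : Type*} [Fintype ι] [Fintype κ] [Fintype V]
    {ℓ : ι → κ} (hℓ : Function.Injective ℓ) (α : ι ↪ V) :
    Nat.card {γ : κ ↪ V // ∀ i, γ (ℓ i) = α i} =
      (Fintype.card V - Fintype.card ι).descFactorial (Fintype.card κ - Fintype.card ι) := by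
  classical
  let e : ι ⊕ ↥(Set.range ℓ)ᶜ ≃ κ :=
    ((Equiv.ofInjective ℓ hℓ).sumCongr (Equiv.refl _)).trans (Equiv.Set.sumCompl (Set.range ℓ))
  let E : (κ ↪ V) ≃ Σ f : ι ↪ V, ↥(Set.range ℓ)ᶜ ↪ ↥(Set.range f)ᶜ :=
    (Equiv.embeddingCongr e.symm (Equiv.refl V)).trans
      Equiv.sumEmbeddingEquivSigmaEmbeddingRestricted
  have hE : ∀ γ : κ ↪ V, (∀ i, γ (ℓ i) = α i) ↔ (E γ).1 = α := fun γ =>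
    ⟨fun h => by ext i; exact h i, fun h i => by rw [← h]; rfl⟩
  rw [Nat.card_congr ((E.subtypeEquiv hE).trans (Equiv.sigmaSubtype α)), Nat.card_eq_fintype_card,
    Fintype.card_embedding_eq, Fintype.card_compl_set, Fintype.card_compl_set,
    Set.card_range_of_injective hℓ, Set.card_range_of_injective α.injective]

lemma card_filter_extending {k p n : ℕ} {ℓ : Fin k → Fin p} (hℓ : Function.Injective ℓ)
    {α : Fin k → Fin n} (hα : Function.Injective α)
    [DecidablePred fun γ : Fin p ↪ Fin n => ∀ i, γ (ℓ i) = α i] :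
    (Finset.univ.filter fun γ : Fin p ↪ Fin n => ∀ i, γ (ℓ i) = α i).card =
      (n - k).descFactorial (p - k) := by
  have := card_embedding_extending (V := Fin n) hℓ ⟨α, hα⟩
  simp only [Fintype.card_fin, Function.Embedding.coeFn_mk] at this
  rw [← this, Nat.card_eq_fintype_card, Fintype.card_subtype]

/-- If all but at most `B` of the products `Z γ * Z γ'` have mean zero for each `γ`, then the
second moment of the average of the `Z γ` is at most `C * B / |s|`. -/
lemma integral_sq_average_le {Ω Γ : Type*} [MeasurableSpace Ω] {P : Measure Ω}
    [IsProbabilityMeasure P] (s : Finset Γ) (hs : s.Nonempty) (Z : Γ → Ω → ℝ)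
    (hZ : ∀ γ, BddMeas (Z γ)) {C : ℝ} (hC : ∀ γ ω, |Z γ ω| ≤ C) (bad : Γ → Γ → Prop)
    [∀ γ, DecidablePred (bad γ)]
    (hgood : ∀ γ ∈ s, ∀ γ' ∈ s, ¬ bad γ γ' → ∫ ω, Z γ ω * Z γ' ω ∂P = 0) {B : ℕ}
    (hB : ∀ γ ∈ s, (s.filter (bad γ)).card ≤ B) :
    ∫ ω, ((∑ γ ∈ s, Z γ ω) / s.card) ^ 2 ∂P ≤ C ^ 2 * B / s.card := by
  have hpos : (0 : ℝ) < s.card := by exact_mod_cast hs.card_pos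
  have h1 : ∀ ω, ((∑ γ ∈ s, Z γ ω) / s.card) ^ 2 =
      (∑ γ ∈ s, ∑ γ' ∈ s, Z γ ω * Z γ' ω) / (s.card : ℝ) ^ 2 := by
    intro ω
    rw [div_pow, pow_two (∑ γ ∈ s, Z γ ω), Finset.sum_mul_sum]
  simp_rw [h1]
  rw [integral_div, integral_finsetSum _ fun γ _ =>
    (BddMeas.sum s fun γ' _ => (hZ γ).mul (hZ γ')).integrable P, div_le_div_iff₀ (by positivity) hpos]
  have h2 : ∀ γ ∈ s, ∫ ω, ∑ γ' ∈ s, Z γ ω * Z γ' ω ∂P ≤ C ^ 2 * B := by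
    intro γ hγ
    rw [integral_finsetSum _ fun γ' _ => ((hZ γ).mul (hZ γ')).integrable P,
      ← Finset.sum_filter_add_sum_filter_not s (bad γ),
      Finset.sum_eq_zero (s := s.filter fun γ' => ¬ bad γ γ'), add_zero]
    · have h3 : ∀ γ' ∈ s.filter (bad γ), ∫ ω, Z γ ω * Z γ' ω ∂P ≤ C ^ 2 := by
        intro γ' _
        refine (le_abs_self _).trans (BddMeas.abs_integral_le (fun ω => ?_) P)
        rw [abs_mul, pow_two]
        exact mul_le_mul (hC _ _) (hC _ _) (abs_nonneg _) ((abs_nonneg _).trans (hC γ ω))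
      refine (Finset.sum_le_card_nsmul _ _ _ h3).trans ?_
      rw [nsmul_eq_mul, mul_comm]
      exact mul_le_mul_of_nonneg_left (by exact_mod_cast hB γ hγ) (sq_nonneg C)
    · intro γ' hγ'
      rw [Finset.mem_filter] at hγ'
      exact hgood γ hγ γ' hγ'.1 hγ'.2
  have h4 := Finset.sum_le_card_nsmul _ _ _ h2
  rw [nsmul_eq_mul] at h4
  nlinarith

/-- Averages over embeddings of `[k]` are averages over embeddings of `[p]`. -/
lemma average_extending {k p n : ℕ} {ℓ : Fin k → Fin p}
    (hℓ : Function.Injective ℓ) (f : (Fin k ↪ Fin n) → (Fin p ↪ Fin n) → ℝ)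
    [∀ α : Fin k ↪ Fin n, DecidablePred fun γ : Fin p ↪ Fin n => ∀ i, γ (ℓ i) = α i] :
    (∑ α : Fin k ↪ Fin n, (∑ γ : Fin p ↪ Fin n with ∀ i, γ (ℓ i) = α i, f α γ) /
        ((n - k).descFactorial (p - k) : ℝ)) / (Fintype.card (Fin k ↪ Fin n) : ℝ) =
      (∑ γ : Fin p ↪ Fin n, f ((⟨ℓ, hℓ⟩ : Fin k ↪ Fin p).trans γ) γ) /
        (Fintype.card (Fin p ↪ Fin n) : ℝ) := by
  classical
  -- All fibres of `γ ↦ γ ∘ ℓ` have the same size, so a uniform `γ` restricts to a uniform `α`.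
  have hcard : (Fintype.card (Fin p ↪ Fin n) : ℝ) =
      Fintype.card (Fin k ↪ Fin n) * ((n - k).descFactorial (p - k) : ℝ) := by
    have := Finset.card_eq_sum_card_fiberwise (s := (Finset.univ : Finset (Fin p ↪ Fin n)))
      (t := (Finset.univ : Finset (Fin k ↪ Fin n)))
      (f := fun γ => (⟨ℓ, hℓ⟩ : Fin k ↪ Fin p).trans γ) (fun _ _ => by simp)
    rw [← Finset.card_univ, this]
    have h2 : ∀ α : Fin k ↪ Fin n, (Finset.univ.filter fun γ : Fin p ↪ Fin n =>
        (⟨ℓ, hℓ⟩ : Fin k ↪ Fin p).trans γ = α).card = (n - k).descFactorial (p - k) := by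
      intro α
      rw [← card_filter_extending hℓ α.injective]
      congr 1
      ext γ
      simp only [Finset.mem_filter, Finset.mem_univ, true_and]
      exact ⟨fun h i => by rw [← h]; rfl, fun h => by ext i; rw [← h]; rfl⟩
    simp_rw [h2]
    simp
  rw [hcard, ← Finset.sum_div, div_div, mul_comm (Fintype.card (Fin k ↪ Fin n) : ℝ)]
  congr 1
  rw [← Finset.sum_fiberwise_of_maps_to (s := (Finset.univ : Finset (Fin p ↪ Fin n)))
    (t := (Finset.univ : Finset (Fin k ↪ Fin n)))
    (g := fun γ => (⟨ℓ, hℓ⟩ : Fin k ↪ Fin p).trans γ) (fun _ _ => by simp)]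
  refine Finset.sum_congr rfl fun α _ => ?_
  refine Finset.sum_congr ?_ ?_
  · ext γ
    simp only [Finset.mem_filter, Finset.mem_univ, true_and]
    exact ⟨fun h => by ext i; rw [← h]; rfl, fun h i => by rw [← h]; rfl⟩
  · intro γ hγ
    rw [(Finset.mem_filter.1 hγ).2]

/-- For `α = γ ∘ ℓ`, the number of extensions of `α` that hit `γ` outside of `α`. -/
lemma card_filter_meeting_le {k p n : ℕ} {ℓ : Fin k → Fin p}
    (hℓ : Function.Injective ℓ) {α : Fin k → Fin n} (hα : Function.Injective α)
    (γ : Fin p ↪ Fin n) (hγ : ∀ i, γ (ℓ i) = α i)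
    [DecidablePred fun γ' : Fin p ↪ Fin n => ∀ i, γ' (ℓ i) = α i]
    [DecidablePred fun γ' : Fin p ↪ Fin n => ∃ a a', γ a = γ' a' ∧ a ∉ Set.range ℓ] :
    ((Finset.univ.filter fun γ' : Fin p ↪ Fin n => ∀ i, γ' (ℓ i) = α i).filter
      fun γ' => ∃ a a', γ a = γ' a' ∧ a ∉ Set.range ℓ).card ≤
      p * p * (n - (k + 1)).descFactorial (p - (k + 1)) := by
  classical
  have hsub : ((Finset.univ.filter fun γ' : Fin p ↪ Fin n => ∀ i, γ' (ℓ i) = α i).filter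
      fun γ' => ∃ a a', γ a = γ' a' ∧ a ∉ Set.range ℓ) ⊆
      (Finset.univ : Finset (Fin p × Fin p)).biUnion fun r =>
        Finset.univ.filter fun γ' : Fin p ↪ Fin n =>
          (∀ i, γ' (ℓ i) = α i) ∧ γ r.1 = γ' r.2 ∧ r.1 ∉ Set.range ℓ := by
    intro γ' h
    simp only [Finset.mem_filter, Finset.mem_univ, true_and] at h
    obtain ⟨h1, a, a', h2, h3⟩ := h
    simp only [Finset.mem_biUnion, Finset.mem_filter, Finset.mem_univ, true_and]
    exact ⟨(a, a'), h1, h2, h3⟩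
  refine (Finset.card_le_card hsub).trans ?_
  refine (Finset.card_biUnion_le_card_mul _ _ ((n - (k + 1)).descFactorial (p - (k + 1))) ?_).trans
    (by simp)
  rintro ⟨a, a'⟩ -
  dsimp only
  by_cases ha : a ∈ Set.range ℓ
  · simp [ha]
  by_cases ha' : a' ∈ Set.range ℓ
  · obtain ⟨i, rfl⟩ := ha'
    rw [Finset.filter_false_of_mem]
    · simp
    · rintro γ' - ⟨h1, h2, -⟩
      rw [h1 i, ← hγ i] at h2
      exact ha ⟨i, (γ.injective h2).symm⟩
  -- For a fixed pair `(a, a')`, the condition `γ' a' = γ a` prescribes one more value of `γ'`: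
  -- these are extensions of a word of length `k + 1`.
  have hinj : Function.Injective (Fin.snoc ℓ a' : Fin (k + 1) → Fin p) := 
    Fin.snoc_injective_iff.2 ⟨hℓ, ha'⟩
  have hinj' : Function.Injective (Fin.snoc α (γ a) : Fin (k + 1) → Fin n) := by
    refine Fin.snoc_injective_iff.2 ⟨hα, ?_⟩
    rintro ⟨i, hi⟩
    rw [← hγ i] at hi
    exact ha ⟨i, γ.injective hi⟩
  rw [← card_filter_extending hinj hinj']
  refine Finset.card_le_card fun γ' h => ?_
  simp only [Finset.mem_filter, Finset.mem_univ, true_and] at h ⊢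
  intro i
  induction i using Fin.lastCases with
  | last => simp [h.2.1]
  | cast i => simpa using h.1 i

/-- The number of embeddings meeting a given one in at least two points. -/
lemma card_filter_two_common_le {p n : ℕ} (γ : Fin p ↪ Fin n)
    [DecidablePred fun γ' : Fin p ↪ Fin n =>
      ∃ a b a' b', γ a = γ' a' ∧ γ b = γ' b' ∧ a ≠ b] :
    (Finset.univ.filter fun γ' : Fin p ↪ Fin n =>
      ∃ a b a' b', γ a = γ' a' ∧ γ b = γ' b' ∧ a ≠ b).card ≤
      p * p * (p * p) * (n - 2).descFactorial (p - 2) := by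
  classical
  have hsub : (Finset.univ.filter fun γ' : Fin p ↪ Fin n =>
      ∃ a b a' b', γ a = γ' a' ∧ γ b = γ' b' ∧ a ≠ b) ⊆
      (Finset.univ : Finset ((Fin p × Fin p) × (Fin p × Fin p))).biUnion fun r =>
        Finset.univ.filter fun γ' : Fin p ↪ Fin n =>
          γ r.1.1 = γ' r.2.1 ∧ γ r.1.2 = γ' r.2.2 ∧ r.1.1 ≠ r.1.2 := by
    intro γ' h
    simp only [Finset.mem_filter, Finset.mem_univ, true_and] at h
    obtain ⟨a, b, a', b', h⟩ := h
    simp only [Finset.mem_biUnion, Finset.mem_filter, Finset.mem_univ, true_and]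
    exact ⟨((a, b), (a', b')), h⟩
  refine (Finset.card_le_card hsub).trans ?_
  refine (Finset.card_biUnion_le_card_mul _ _ ((n - 2).descFactorial (p - 2)) ?_).trans
    (by simp)
  rintro ⟨⟨a, b⟩, a', b'⟩ -
  dsimp only
  by_cases hab : a = b
  · simp [hab]
  by_cases hab' : a' = b'
  · subst hab'
    rw [Finset.filter_false_of_mem]
    · simp
    · rintro γ' - ⟨h1, h2, -⟩
      exact hab (γ.injective (h1.trans h2.symm))
  have hpair : ∀ {V : Type} {x y : V}, x ≠ y → Function.Injective ![x, y] := by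
    intro V x y hxy i j h
    fin_cases i <;> fin_cases j <;> simp_all
  rw [← card_filter_extending (hpair hab') (hpair fun h => hab (γ.injective h))]
  refine Finset.card_le_card fun γ' h => ?_
  simp only [Finset.mem_filter, Finset.mem_univ, true_and] at h ⊢
  intro i
  fin_cases i
  · simp [h.1]
  · simp [h.2.1]

/-! ### U-statistics in labels and edges, and their Hájek projection. -/

/-- A function of a `[0,1]`-labelled graph on `[p]`, written as a combination of indicators that
given sets of pairs consist of edges, the coefficients depending on the labels. -/
structure EdgeKernel (p : ℕ) (J : Type*) where
  coef : J → (Fin p → I) → ℝ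
  edges : J → Finset (Sym2 (Fin p))
  bddMeas_coef : ∀ j, BddMeas (coef j)
  not_isDiag : ∀ j, ∀ e ∈ edges j, ¬ e.IsDiag

namespace EdgeKernel

variable {p : ℕ} {J : Type*} [Fintype J] (K : EdgeKernel p J)

/-- The value of the kernel at the copy `γ` of `[p]` in a labelled graph. -/
noncomputable def eval {n : ℕ} (γ : Fin p ↪ Fin n) (x : Fin n → I) (H : SimpleGraph (Fin n)) : ℝ :=
  ∑ j, K.coef j (fun i => x (γ i)) * ∏ e ∈ K.edges j, edgeInd H (e.map γ)

/-- The conditional mean of the kernel given the labels. -/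
noncomputable def mean (W : Graphon) (x : Fin p → I) : ℝ :=
  ∑ j, K.coef j x * ∏ e ∈ K.edges j, W.edgeVal x e

/-- The conditional mean of the kernel given the label of `q`. -/
noncomputable def proj (W : Graphon) (q : Fin p) (u : I) : ℝ :=
  ∫ z, K.mean W (Function.update z q u)

lemma bddMeas_mean (W : Graphon) : BddMeas (K.mean W) :=
  BddMeas.sum _ fun j _ => (K.bddMeas_coef j).mul (BddMeas.prod _ fun e _ => BddMeas.edgeVal W e)

lemma bddMeas_proj (W : Graphon) (q : Fin p) : BddMeas (K.proj W q) := by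
  refine BddMeas.integral_right
    (f := fun z : I × (Fin p → I) => K.mean W (Function.update z.2 q z.1)) ?_ _
  refine (K.bddMeas_mean W).comp (measurable_pi_lambda _ fun j => ?_)
  by_cases h : j = q
  · subst h; simpa using measurable_fst
  · simp only [Function.update_of_ne h]
    fun_prop

lemma integral_proj (W : Graphon) (q : Fin p) : ∫ u, K.proj W q u = ∫ x, K.mean W x :=
  (integral_update q (K.bddMeas_mean W)).symm

lemma exists_bound : ∃ C, ∀ (n : ℕ) (γ : Fin p ↪ Fin n) (x : Fin n → I) (H : SimpleGraph (Fin n)),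
    |K.eval γ x H| ≤ C := by
  choose C hC using fun j => (K.bddMeas_coef j).bdd
  refine ⟨∑ j, C j, fun n γ x H => (Finset.abs_sum_le_sum_abs _ _).trans
    (Finset.sum_le_sum fun j _ => ?_)⟩
  rw [abs_mul, Finset.abs_prod]
  refine (mul_le_of_le_one_right (abs_nonneg _) (Finset.prod_le_one (fun _ _ => abs_nonneg _) ?_)).trans
    (hC j _)
  intro e _
  unfold edgeInd
  split_ifs <;> simp

variable {Ω : Type*} [MeasurableSpace Ω] {P : Measure Ω}
  {W : Graphon} {X : ℕ → Ω → I} {G : (n : ℕ) → Ω → SimpleGraph (Fin n)}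

lemma bddMeas_eval (hG : IsWRandomGraph W P X G) {n : ℕ} (γ : Fin p ↪ Fin n) :
    BddMeas (fun ω => K.eval γ (fun i => X i ω) (G n ω)) :=
  BddMeas.sum _ fun j _ => (hG.bddMeas_X (n := n) ((K.bddMeas_coef j).comp
    (measurable_pi_lambda (fun (x : Fin n → I) i => x (γ i)) fun _ => measurable_pi_apply _))).mul
    (BddMeas.prod _ fun e _ => hG.bddMeas_graph fun H => edgeInd H (e.map γ))

/-- Copies with at most one common vertex share no edge, so the edge indicators can be replaced
by their conditional means. -/
lemma integral_eval_mul_eval [IsProbabilityMeasure P]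
    (hG : IsWRandomGraph W P X G) {n : ℕ} (γ γ' : Fin p ↪ Fin n)
    (h : ¬ ∃ a b a' b', γ a = γ' a' ∧ γ b = γ' b' ∧ a ≠ b) :
    ∫ ω, K.eval γ (fun i => X i ω) (G n ω) * K.eval γ' (fun i => X i ω) (G n ω) ∂P =
      ∫ x : Fin n → I, K.mean W (fun i => x (γ i)) * K.mean W (fun i => x (γ' i)) := by
  have hc : ∀ j (γ : Fin p ↪ Fin n), BddMeas (fun x : Fin n → I => K.coef j fun i => x (γ i)) :=
    fun j γ => (K.bddMeas_coef j).comp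
      (measurable_pi_lambda (fun (x : Fin n → I) i => x (γ i)) fun i => measurable_pi_apply _)
  have hW : ∀ j (γ : Fin p ↪ Fin n),
      BddMeas (fun x : Fin n → I => ∏ e ∈ K.edges j, W.edgeVal (fun i => x (γ i)) e) :=
    fun j γ => BddMeas.prod _ fun e _ => (BddMeas.edgeVal W e).comp
      (measurable_pi_lambda (fun (x : Fin n → I) i => x (γ i)) fun i => measurable_pi_apply _)
  have hE : ∀ j (γ : Fin p ↪ Fin n),
      BddMeas (fun ω => ∏ e ∈ K.edges j, edgeInd (G n ω) (e.map γ)) :=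
    fun j γ => BddMeas.prod _ fun e _ => hG.bddMeas_graph fun H => edgeInd H (e.map γ)
  have hmul : ∀ a b a' b' : J → ℝ, (∑ j, a j * b j) * ∑ j, a' j * b' j =
      ∑ j, ∑ j', (a j * a' j') * (b j * b' j') := fun a b a' b' => by
    simp only [Finset.sum_mul_sum, mul_mul_mul_comm]
  simp only [eval, mean, hmul]
  rw [integral_finsetSum _ fun j _ => (BddMeas.sum _ fun j' _ =>
      (hG.bddMeas_X ((hc j γ).mul (hc j' γ'))).mul ((hE j γ).mul (hE j' γ'))).integrable P,
    integral_finsetSum _ fun j _ => (BddMeas.sum _ fun j' _ =>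
      ((hc j γ).mul (hc j' γ')).mul ((hW j γ).mul (hW j' γ'))).integrable _]
  refine Finset.sum_congr rfl fun j _ => ?_
  rw [integral_finsetSum _ fun j' _ =>
      ((hG.bddMeas_X ((hc j γ).mul (hc j' γ'))).mul ((hE j γ).mul (hE j' γ'))).integrable P,
    integral_finsetSum _ fun j' _ =>
      (((hc j γ).mul (hc j' γ')).mul ((hW j γ).mul (hW j' γ'))).integrable _]
  refine Finset.sum_congr rfl fun j' _ => ?_
  refine hG.integral_mul_prod_two ((hc j γ).mul (hc j' γ')) γ γ' _ _ (K.not_isDiag j)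
    (K.not_isDiag j') ?_
  intro e he e' _ heq
  have hd := K.not_isDiag j e he
  induction e with | _ a b
  induction e' with | _ a' b'
  rw [Sym2.mk_isDiag_iff] at hd
  rw [Sym2.map_mk, Sym2.map_mk, Sym2.eq_iff] at heq
  rcases heq with h' | h'
  · exact h ⟨a, b, a', b', h'.1, h'.2, hd⟩
  · exact h ⟨a, b, b', a', h'.1, h'.2, hd⟩

/-- Complete degeneracy: the mean vanishes conditionally on any one label. -/
lemma integral_mean_mul_mean (hK : ∀ q u, K.proj W q u = 0) (hp : 0 < p) {n : ℕ}
    (γ γ' : Fin p ↪ Fin n) (h : ¬ ∃ a b a' b', γ a = γ' a' ∧ γ b = γ' b' ∧ a ≠ b) :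
    ∫ x : Fin n → I, K.mean W (fun i => x (γ i)) * K.mean W (fun i => x (γ' i)) = 0 := by
  have hm : ∀ γ : Fin p ↪ Fin n, BddMeas (fun x : Fin n → I => K.mean W fun i => x (γ i)) :=
    fun γ => (K.bddMeas_mean W).comp
      (measurable_pi_lambda (fun (x : Fin n → I) i => x (γ i)) fun i => measurable_pi_apply _)
  have h0 : ∫ x, K.mean W x = 0 := by
    rw [← K.integral_proj W ⟨0, hp⟩]
    simp [hK]
  -- Freeze the labels on the image of `γ'`. The factor of `γ'` becomes constant, and in the factor
  -- of `γ` at most one label is frozen, so its integral is a value of `proj` or the full mean, both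
  -- zero.
  rw [integral_extend γ'.injective ((hm γ).mul (hm γ'))]
  refine integral_eq_zero_of_ae (.of_forall fun x => ?_)
  have h1 : ∀ y : Fin n → I, (fun i => Function.extend γ' x y (γ' i)) = x := fun y => by
    ext1 i
    exact γ'.injective.extend_apply _ _ _
  simp only [h1, Pi.zero_apply]
  rw [integral_mul_const]
  by_cases hq : ∃ q q', γ q = γ' q'
  · obtain ⟨q, q', hqq⟩ := hq
    have h2 : ∀ y : Fin n → I, (fun i => Function.extend γ' x y (γ i)) =
        Function.update (fun i => y (γ i)) q (x q') := by
      intro y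
      ext1 i
      by_cases hi : i = q
      · subst hi
        rw [hqq, γ'.injective.extend_apply, Function.update_self]
      · rw [Function.update_of_ne hi, Function.extend_apply']
        rintro ⟨i', hi'⟩
        exact h ⟨i, q, i', q', hi'.symm, hqq, hi⟩
    simp_rw [h2]
    rw [integral_precomp γ.injective (φ := fun z => K.mean W (Function.update z q (x q')))]
    · have := hK q (x q')
      rw [proj] at this
      rw [this, zero_mul]
    · refine (K.bddMeas_mean W).comp ?_
      exact measurable_update'.comp (measurable_id.prodMk measurable_const)
  · have h2 : ∀ y : Fin n → I, (fun i => Function.extend γ' x y (γ i)) = fun i => y (γ i) := by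
      intro y
      ext1 i
      rw [Function.extend_apply']
      rintro ⟨i', hi'⟩
      exact hq ⟨i, i', hi'.symm⟩
    simp_rw [h2]
    rw [integral_precomp γ.injective (K.bddMeas_mean W), h0, zero_mul]

/-- Only pairs of copies with two common vertices contribute to the second moment, and they form a
proportion `O(n^(-2))` of all pairs. -/
lemma exists_integral_sq_average_le_of_degenerate [IsProbabilityMeasure P]
    (hG : IsWRandomGraph W P X G)
    (hK : ∀ q u, K.proj W q u = 0) (hp : 0 < p) :
    ∃ C, ∀ n, p ≤ n → 2 ≤ n →
      ∫ ω, ((∑ γ : Fin p ↪ Fin n, K.eval γ (fun i => X i ω) (G n ω)) /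
        Fintype.card (Fin p ↪ Fin n)) ^ 2 ∂P ≤ C / (n : ℝ) ^ 2 := by
  classical
  obtain ⟨C, hC⟩ := K.exists_bound
  refine ⟨C ^ 2 * (p * p * (p * p)) * 2, fun n hpn hn => ?_⟩
  have hne : (Finset.univ : Finset (Fin p ↪ Fin n)).Nonempty :=
    ⟨Fin.castLEEmb hpn, Finset.mem_univ _⟩
  have hgood : ∀ γ ∈ (Finset.univ : Finset (Fin p ↪ Fin n)),
      ∀ γ' ∈ (Finset.univ : Finset (Fin p ↪ Fin n)),
      ¬ (∃ a b a' b', γ a = γ' a' ∧ γ b = γ' b' ∧ a ≠ b) →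
      ∫ ω, K.eval γ (fun i => X i ω) (G n ω) * K.eval γ' (fun i => X i ω) (G n ω) ∂P = 0 :=
    fun γ _ γ' _ h => by
      rw [K.integral_eval_mul_eval hG γ γ' h, K.integral_mean_mul_mean hK hp γ γ' h]
  have key := fun B => integral_sq_average_le (P := P) (B := B) Finset.univ hne
    (fun γ ω => K.eval γ (fun i => X i ω) (G n ω)) (K.bddMeas_eval hG)
    (fun γ ω => hC n γ _ _) _ hgood
  -- For `p = 1` two distinct common vertices are impossible, and the truncated `p - 2` in the
  -- counting bound would be meaningless.
  rcases lt_or_ge p 2 with hp2 | hp2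
  · refine (key 0 fun γ _ => ?_).trans ?_
    · rw [Nat.le_zero, Finset.card_eq_zero, Finset.filter_eq_empty_iff]
      rintro γ' - ⟨a, b, -, -, -, -, hab⟩
      exact hab (Fin.ext (by omega))
    · simp only [Nat.cast_zero, mul_zero, zero_div]
      positivity
  · refine (key _ fun γ _ => card_filter_two_common_le γ).trans ?_
    obtain ⟨m, rfl⟩ := Nat.exists_eq_add_of_le' hn
    obtain ⟨r, rfl⟩ := Nat.exists_eq_add_of_le' hp2
    have hD : (0 : ℝ) < m.descFactorial r := by
      exact_mod_cast Nat.pos_of_ne_zero (by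
        rw [Ne, Nat.descFactorial_eq_zero_iff_lt]; omega)
    rw [Finset.card_univ, Fintype.card_embedding_eq, Fintype.card_fin, Fintype.card_fin,
      Nat.succ_descFactorial_succ, Nat.succ_descFactorial_succ]
    simp only [Nat.add_sub_cancel]
    push_cast
    rw [div_le_div_iff₀ (by positivity) (by positivity)]
    have hm : (0 : ℝ) ≤ m := Nat.cast_nonneg m
    -- With `n = m + 2` this is `n ^ 2 ≤ 2 * n * (n - 1)`, the origin of the factor 2 in the
    -- constant.
    have h1 : ((m : ℝ) + 2) ^ 2 ≤ 2 * ((m + 1 + 1) * (m + 1)) := by nlinarith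
    have h2 : 0 ≤ C ^ 2 * (((r : ℝ) + 2) * (r + 2) * ((r + 2) * (r + 2))) * m.descFactorial r := by
      positivity
    nlinarith [mul_le_mul_of_nonneg_left h1 h2]

/-- The kernel minus its Hájek projection. -/
noncomputable def degeneratePart (W : Graphon) : EdgeKernel p (Option J) where
  -- The extra index `none` has no edges, so its coefficient is a correction depending on the labels
  -- alone.
  coef j := j.elim (fun x => -(∫ x, K.mean W x) - ∑ q, (K.proj W q (x q) - ∫ x, K.mean W x)) K.coef
  edges j := j.elim ∅ K.edges
  bddMeas_coef j := by
    cases j with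
    | none => exact (BddMeas.const _).sub (BddMeas.sum _ fun q _ =>
        ((K.bddMeas_proj W q).comp (measurable_pi_apply q)).sub (BddMeas.const _))
    | some j => exact K.bddMeas_coef j
  not_isDiag j := by
    cases j with
    | none => simp
    | some j => exact K.not_isDiag j

lemma degeneratePart_mean (x : Fin p → I) : (K.degeneratePart W).mean W x =
    K.mean W x - (∫ x, K.mean W x) - ∑ q, (K.proj W q (x q) - ∫ x, K.mean W x) := by
  rw [mean, Fintype.sum_option]
  change (-(∫ x, K.mean W x) - ∑ q, (K.proj W q (x q) - ∫ x, K.mean W x)) *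
    ∏ e ∈ ∅, W.edgeVal x e + K.mean W x = _
  rw [Finset.prod_empty]
  ring

lemma degeneratePart_eval {n : ℕ} (γ : Fin p ↪ Fin n) (x : Fin n → I) (H : SimpleGraph (Fin n)) :
    (K.degeneratePart W).eval γ x H = K.eval γ x H - (∫ x, K.mean W x) -
      ∑ q, (K.proj W q (x (γ q)) - ∫ x, K.mean W x) := by
  rw [eval, Fintype.sum_option]
  change (-(∫ x, K.mean W x) - ∑ q, (K.proj W q (x (γ q)) - ∫ x, K.mean W x)) *
    ∏ e ∈ ∅, edgeInd H (Sym2.map γ e) + K.eval γ x H = _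
  rw [Finset.prod_empty]
  ring

/-- Given the label of `q`, the centred projections at the other vertices integrate to zero, and the
one at `q` cancels the centred conditional mean of the kernel. -/
lemma degeneratePart_proj (q : Fin p) (u : I) : (K.degeneratePart W).proj W q u = 0 := by
  have hup : Measurable fun z : Fin p → I => Function.update z q u :=
    measurable_update'.comp (measurable_id.prodMk measurable_const)
  have hq : ∀ q', BddMeas fun z : Fin p → I =>
      K.proj W q' (Function.update z q u q') - ∫ x, K.mean W x := fun q' =>
    ((K.bddMeas_proj W q').comp ((measurable_pi_apply q').comp hup)).sub (BddMeas.const _)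
  have hm : BddMeas fun z : Fin p → I => K.mean W (Function.update z q u) :=
    (K.bddMeas_mean W).comp hup
  unfold proj
  simp only [degeneratePart_mean]
  rw [integral_sub ((hm.sub (BddMeas.const _)).integrable _)
    ((BddMeas.sum _ fun q' _ => hq q').integrable _), integral_sub (hm.integrable _)
    (integrable_const _), integral_finsetSum _ fun q' _ => (hq q').integrable _,
    Finset.sum_eq_single q]
  · simp only [Function.update_self, integral_const, probReal_univ, one_smul]
    rw [proj, sub_self]
  · intro q' _ hne
    simp only [Function.update_of_ne hne]
    rw [integral_eval q' (φ := fun u => K.proj W q' u - ∫ x, K.mean W x)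
      ((K.bddMeas_proj W q').sub (BddMeas.const _)),
      integral_sub ((K.bddMeas_proj W q').integrable _) (integrable_const _), K.integral_proj]
    simp
  · simp

/-- The average of a kernel over all copies of `[p]` is, up to `O(1/n)` in `L²`, its mean plus an
average of independent centred variables. -/
lemma exists_integral_sq_average_sub_le [IsProbabilityMeasure P]
    (hG : IsWRandomGraph W P X G) (hp : 0 < p) :
    ∃ C, ∀ n, p ≤ n → 2 ≤ n →
      ∫ ω, ((∑ γ : Fin p ↪ Fin n, K.eval γ (fun i => X i ω) (G n ω)) /
        Fintype.card (Fin p ↪ Fin n) - (∫ x, K.mean W x) -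
        (∑ i : Fin n, ∑ q, (K.proj W q (X i ω) - ∫ x, K.mean W x)) / n) ^ 2 ∂P ≤
          C / (n : ℝ) ^ 2 := by
  classical
  obtain ⟨C, hC⟩ := (K.degeneratePart W).exists_integral_sq_average_le_of_degenerate hG
    K.degeneratePart_proj hp
  refine ⟨C, fun n hpn hn => le_of_eq_of_le ?_ (hC n hpn hn)⟩
  refine integral_congr_ae (.of_forall fun ω => ?_)
  dsimp only
  congr 1
  simp only [degeneratePart_eval]
  have hN : (Fintype.card (Fin p ↪ Fin n) : ℝ) ≠ 0 := by
    have : Nonempty (Fin p ↪ Fin n) := ⟨Fin.castLEEmb hpn⟩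
    exact_mod_cast Fintype.card_ne_zero
  rw [Finset.sum_sub_distrib, Finset.sum_sub_distrib, Finset.sum_const, Finset.card_univ,
    nsmul_eq_mul, sub_div, sub_div, mul_div_cancel_left₀ _ hN, Finset.sum_comm,
    Finset.sum_comm (s := (Finset.univ : Finset (Fin p ↪ Fin n)))]
  congr 1
  rw [Finset.sum_div, Finset.sum_div]
  refine Finset.sum_congr rfl fun q _ => ?_
  -- A function of `γ q` alone is averaged over words of length one, that is, over `[n]`.
  have h := average_extending (k := 1) (p := p) (n := n) (ℓ := fun _ => q)
    (fun _ _ _ => Subsingleton.elim _ _)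
    (fun α _ => K.proj W q (X (α 0) ω) - ∫ x, K.mean W x)
  rw [show (∑ γ : Fin p ↪ Fin n, (K.proj W q (X (γ q) ω) - ∫ x, K.mean W x)) /
    (Fintype.card (Fin p ↪ Fin n) : ℝ) = _ from h.symm]
  have hM : ((n - 1).descFactorial (p - 1) : ℝ) ≠ 0 := by
    have : (n - 1).descFactorial (p - 1) ≠ 0 := by
      rw [Ne, Nat.descFactorial_eq_zero_iff_lt]; omega
    exact_mod_cast this
  have h2 : ∀ α : Fin 1 ↪ Fin n, (Finset.univ.filter fun γ : Fin p ↪ Fin n =>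
      ∀ i : Fin 1, γ q = α i).card = (n - 1).descFactorial (p - 1) := fun α =>
    card_filter_extending (ℓ := fun _ : Fin 1 => q) (fun _ _ _ => Subsingleton.elim _ _) α.injective
  simp only [Finset.sum_const, h2, nsmul_eq_mul, mul_div_cancel_left₀ _ hM]
  rw [Fintype.card_embedding_eq]
  simp only [Fintype.card_fin, Nat.descFactorial_one]
  congr 1
  refine Fintype.sum_equiv (Equiv.uniqueEmbeddingEquivResult (α := Fin 1)).symm _ _ fun i => ?_
  rfl

end EdgeKernel

/-! ### Splitting the edges of `F` into labelled and remaining ones. -/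

section LabelledGraph

variable {k p : ℕ} (F : SimpleGraph (Fin p)) (ℓ : Fin k → Fin p) (W : Graphon)

open Classical in
/-- All edges of `F`, as a finset. -/
noncomputable def edgesAll : Finset (Sym2 (Fin p)) :=
  Finset.univ.filter fun e => e ∈ F.edgeSet

open Classical in
/-- The edges of `F` with both ends labelled. -/
noncomputable def edgesIn : Finset (Sym2 (Fin p)) :=
  Finset.univ.filter fun e => e ∈ F.edgeSet ∧ ∀ v ∈ e, v ∈ Set.range ℓ

open Classical in
/-- The edges of `F` with an unlabelled end. -/
noncomputable def edgesOut : Finset (Sym2 (Fin p)) :=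
  Finset.univ.filter fun e => e ∈ F.edgeSet ∧ ¬ ∀ v ∈ e, v ∈ Set.range ℓ

open Classical in
/-- The indicator that `α` maps labelled edges of `F` to edges of `H`. -/
noncomputable def labelledInd {n : ℕ} (α : Fin k → Fin n) (H : SimpleGraph (Fin n)) : ℝ :=
  ∏ e : Sym2 (Fin k) with e ∈ (F.comap ℓ).edgeSet, edgeInd H (e.map α)

variable {F ℓ}

lemma mem_edgesAll {e : Sym2 (Fin p)} : e ∈ edgesAll F ↔ e ∈ F.edgeSet := by simp [edgesAll]

lemma mem_edgesIn {e : Sym2 (Fin p)} :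
    e ∈ edgesIn F ℓ ↔ e ∈ F.edgeSet ∧ ∀ v ∈ e, v ∈ Set.range ℓ := by simp [edgesIn]

lemma mem_edgesOut {e : Sym2 (Fin p)} :
    e ∈ edgesOut F ℓ ↔ e ∈ F.edgeSet ∧ ¬ ∀ v ∈ e, v ∈ Set.range ℓ := by simp [edgesOut]

variable (F ℓ)

lemma prod_edgesIn_mul_prod_edgesOut (f : Sym2 (Fin p) → ℝ) :
    (∏ e ∈ edgesIn F ℓ, f e) * ∏ e ∈ edgesOut F ℓ, f e = ∏ e ∈ edgesAll F, f e := by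
  classical
  rw [← Finset.prod_filter_mul_prod_filter_not (edgesAll F) (fun e => ∀ v ∈ e, v ∈ Set.range ℓ)]
  congr 1 <;> refine Finset.prod_congr ?_ fun _ _ => rfl <;> ext e <;>
    simp [mem_edgesAll, mem_edgesIn, mem_edgesOut]

open Classical in
lemma prod_comap_edges (hℓ : Function.Injective ℓ) (f : Sym2 (Fin p) → ℝ) :
    ∏ e : Sym2 (Fin k) with e ∈ (F.comap ℓ).edgeSet, f (e.map ℓ) = ∏ e ∈ edgesIn F ℓ, f e := by
  refine Finset.prod_bij (fun e _ => e.map ℓ) ?_ ?_ ?_ fun _ _ => rfl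
  · intro e he
    rw [mem_edgesIn]
    induction e with | _ a b =>
    simp only [Finset.mem_filter, Finset.mem_univ, true_and, SimpleGraph.mem_edgeSet,
      SimpleGraph.comap_adj] at he
    refine ⟨he, fun v hv => ?_⟩
    rw [Sym2.map_mk, Sym2.mem_iff] at hv
    rcases hv with rfl | rfl <;> exact ⟨_, rfl⟩
  · intro e _ e' _ h
    exact Sym2.map.injective hℓ h
  · intro e he
    rw [mem_edgesIn] at he
    induction e with | _ a b =>
    obtain ⟨i, rfl⟩ := he.2 a (Sym2.mem_mk_left _ _)
    obtain ⟨j, rfl⟩ := he.2 b (Sym2.mem_mk_right _ _)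
    exact ⟨s(i, j), by simpa using he.1, rfl⟩

variable {ℓ}

lemma tHat_eq_prod (hℓ : Function.Injective ℓ) (y : Fin p → I) :
    tHat F ℓ W (fun i => y (ℓ i)) = ∏ e ∈ edgesIn F ℓ, W.edgeVal y e := by
  rw [← prod_comap_edges F ℓ hℓ, tHat]
  refine Finset.prod_congr rfl fun e _ => ?_
  rw [edgeVal_map]

lemma tHat_mul_zTilde (hℓ : Function.Injective ℓ) (y : Fin p → I) :
    tHat F ℓ W (fun i => y (ℓ i)) * zTilde F ℓ W y = ∏ e ∈ edgesAll F, W.edgeVal y e := by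
  rw [tHat_eq_prod F W hℓ, ← prod_edgesIn_mul_prod_edgesOut F ℓ]
  rfl

lemma labelledInd_eq_prod (hℓ : Function.Injective ℓ) {n : ℕ} {α : Fin k → Fin n}
    {γ : Fin p → Fin n} (hγ : ∀ i, γ (ℓ i) = α i) (H : SimpleGraph (Fin n)) :
    labelledInd F ℓ α H = ∏ e ∈ edgesIn F ℓ, edgeInd H (e.map γ) := by
  rw [← prod_comap_edges F ℓ hℓ (fun e => edgeInd H (e.map γ)), labelledInd]
  refine Finset.prod_congr rfl fun e _ => ?_
  rw [Sym2.map_map]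
  congr 2
  ext1 i
  exact (hγ i).symm

lemma labelledInd_mul_prod (hℓ : Function.Injective ℓ) {n : ℕ} {α : Fin k → Fin n}
    {γ : Fin p → Fin n} (hγ : ∀ i, γ (ℓ i) = α i) (H : SimpleGraph (Fin n)) :
    labelledInd F ℓ α H * ∏ e ∈ edgesOut F ℓ, edgeInd H (e.map γ) =
      ∏ e ∈ edgesAll F, edgeInd H (e.map γ) := by
  rw [labelledInd_eq_prod F hℓ hγ, prod_edgesIn_mul_prod_edgesOut F ℓ]

lemma edgeInd_eq {V : Type*} (H : SimpleGraph V) (e : Sym2 V) :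
    edgeInd H e = 0 ∨ edgeInd H e = 1 := by
  unfold edgeInd
  split_ifs <;> simp

lemma edgeInd_mem_Icc {V : Type*} (H : SimpleGraph V) (e : Sym2 V) :
    edgeInd H e ∈ Set.Icc (0 : ℝ) 1 := by
  rcases edgeInd_eq H e with h | h <;> simp [h]

lemma prod_edgeInd_mem_Icc {V ι : Type*} (H : SimpleGraph V) (s : Finset ι) (f : ι → Sym2 V) :
    ∏ e ∈ s, edgeInd H (f e) ∈ Set.Icc (0 : ℝ) 1 :=
  ⟨Finset.prod_nonneg fun _ _ => (edgeInd_mem_Icc H _).1,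
    Finset.prod_le_one (fun _ _ => (edgeInd_mem_Icc H _).1) fun _ _ => (edgeInd_mem_Icc H _).2⟩

lemma labelledInd_eq {n : ℕ} (α : Fin k → Fin n) (H : SimpleGraph (Fin n)) :
    labelledInd F ℓ α H = 0 ∨ labelledInd F ℓ α H = 1 := by
  classical
  unfold labelledInd
  by_cases h : ∃ e ∈ (Finset.univ.filter fun e : Sym2 (Fin k) => e ∈ (F.comap ℓ).edgeSet),
      edgeInd H (e.map α) = 0
  · obtain ⟨e, he, h⟩ := h
    exact .inl (Finset.prod_eq_zero he h)
  · push Not at h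
    exact .inr (Finset.prod_eq_one fun e he => (edgeInd_eq H _).resolve_left (h e he))

lemma zTilde_mem_Icc (y : Fin p → I) : zTilde F ℓ W y ∈ Set.Icc (0 : ℝ) 1 :=
  ⟨Finset.prod_nonneg fun _ _ => (edgeVal_mem_Icc W _ _).1,
    Finset.prod_le_one (fun _ _ => (edgeVal_mem_Icc W _ _).1) fun _ _ => (edgeVal_mem_Icc W _ _).2⟩

lemma bddMeas_zTilde : BddMeas (zTilde F ℓ W) :=
  BddMeas.prod _ fun e _ => BddMeas.edgeVal W e

lemma bddMeas_tHat : BddMeas (tHat F ℓ W) :=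
  BddMeas.prod _ fun e _ => BddMeas.edgeVal W e

lemma bddMeas_tTilde : BddMeas (tTilde F ℓ W) :=
  BddMeas.integral_right
    (f := fun z : (Fin k → I) × (Fin p → I) => zTilde F ℓ W (Function.extend ℓ z.1 z.2))
    ((bddMeas_zTilde F W).comp (measurable_extend ℓ)) _

lemma integrable_zTilde_extend (x : Fin k → I) :
    Integrable fun y : Fin p → I => zTilde F ℓ W (Function.extend ℓ x y) :=
  ((bddMeas_zTilde F W).comp ((measurable_extend ℓ).comp
    (measurable_const.prodMk measurable_id))).integrable _

lemma tTilde_mem_Icc (x : Fin k → I) : tTilde F ℓ W x ∈ Set.Icc (0 : ℝ) 1 := by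
  refine ⟨integral_nonneg fun y => (zTilde_mem_Icc F W _).1, ?_⟩
  refine (integral_mono (integrable_zTilde_extend F W x) (integrable_const 1)
    fun y => (zTilde_mem_Icc F W _).2).trans ?_
  simp

lemma tHat_congr {F F' : SimpleGraph (Fin p)} (h : F.comap ℓ = F'.comap ℓ) (x : Fin k → I) :
    tHat F ℓ W x = tHat F' ℓ W x := by
  unfold tHat
  refine Finset.prod_congr ?_ fun _ _ => rfl
  ext e
  simp only [Finset.mem_filter, h]

lemma labelledInd_congr {F F' : SimpleGraph (Fin p)} (h : F.comap ℓ = F'.comap ℓ) {n : ℕ}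
    (α : Fin k → Fin n) (H : SimpleGraph (Fin n)) :
    labelledInd F ℓ α H = labelledInd F' ℓ α H := by
  unfold labelledInd
  refine Finset.prod_congr ?_ fun _ _ => rfl
  ext e
  simp only [Finset.mem_filter, h]

lemma SameLabelledEdges.comap_eq {d : ℕ} {F : Fin d → SimpleGraph (Fin p)}
    (hF : SameLabelledEdges F ℓ) (m m' : Fin d) : (F m).comap ℓ = (F m').comap ℓ := by
  ext i j
  exact hF m m' i j

end LabelledGraph

/-! ### Injective densities as averages over embeddings. -/

section InjectiveDensity

variable {k p n : ℕ} (F : SimpleGraph (Fin p)) {ℓ : Fin k → Fin p}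

lemma prod_edgeInd_eq_ite (H : SimpleGraph (Fin n)) (γ : Fin p ↪ Fin n)
    [Decidable (∀ a b, F.Adj a b → H.Adj (γ a) (γ b))] :
    ∏ e ∈ edgesAll F, edgeInd H (e.map γ) =
      if ∀ a b, F.Adj a b → H.Adj (γ a) (γ b) then 1 else 0 := by
  split_ifs with h
  · refine Finset.prod_eq_one fun e he => ?_
    rw [mem_edgesAll] at he
    induction e with | _ a b
    have : s(γ a, γ b) ∈ H.edgeSet := h a b he
    simp [edgeInd, this, -SimpleGraph.mem_edgeSet]
  · push Not at h
    obtain ⟨a, b, hab, hn⟩ := h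
    refine Finset.prod_eq_zero (i := s(a, b)) (mem_edgesAll.2 hab) ?_
    have : s(γ a, γ b) ∉ H.edgeSet := hn
    simp [edgeInd, this, -SimpleGraph.mem_edgeSet]

lemma tInj_eq_average (ℓ : Fin k → Fin p) (H : SimpleGraph (Fin n)) (α : Fin k → Fin n)
    [DecidablePred fun γ : Fin p ↪ Fin n => ∀ i, γ (ℓ i) = α i] :
    tInj F ℓ H α = (∑ γ : Fin p ↪ Fin n with ∀ i, γ (ℓ i) = α i,
      ∏ e ∈ edgesAll F, edgeInd H (e.map γ)) / ((n - k).descFactorial (p - k) : ℝ) := by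
  classical
  unfold tInj
  congr 1
  simp only [prod_edgeInd_eq_ite]
  rw [Finset.sum_boole, Finset.filter_filter]
  congr 1
  have e : {φ : F →g H // Function.Injective φ ∧ ∀ i, φ (ℓ i) = α i} ≃
      {γ : Fin p ↪ Fin n // (∀ i, γ (ℓ i) = α i) ∧ ∀ a b, F.Adj a b → H.Adj (γ a) (γ b)} :=
    { toFun φ := ⟨⟨φ.1, φ.2.1⟩, φ.2.2, fun _ _ h => φ.1.map_adj h⟩
      invFun γ := ⟨⟨γ.1, fun h => γ.2.2 _ _ h⟩, γ.1.injective, γ.2.1⟩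
      left_inv φ := rfl
      right_inv γ := rfl }
  rw [Nat.card_congr e, Nat.card_eq_fintype_card, Fintype.card_subtype]

lemma tInj_mem_Icc (hℓ : Function.Injective ℓ) (H : SimpleGraph (Fin n)) {α : Fin k → Fin n}
    (hα : Function.Injective α) : tInj F ℓ H α ∈ Set.Icc (0 : ℝ) 1 := by
  classical
  rw [tInj_eq_average]
  refine ⟨div_nonneg (Finset.sum_nonneg fun γ _ => (prod_edgeInd_mem_Icc H _ _).1)
    (Nat.cast_nonneg _), div_le_one_of_le₀ ?_ (Nat.cast_nonneg _)⟩
  refine (Finset.sum_le_card_nsmul _ _ 1 fun γ _ => (prod_edgeInd_mem_Icc H _ _).2).trans ?_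
  rw [card_filter_extending hℓ hα]
  simp

lemma tInj_eq_zero (hℓ : Function.Injective ℓ) {H : SimpleGraph (Fin n)} {α : Fin k → Fin n}
    (h : labelledInd F ℓ α H = 0) : tInj F ℓ H α = 0 := by
  classical
  rw [tInj_eq_average, Finset.sum_eq_zero, zero_div]
  intro γ hγ
  rw [← labelledInd_mul_prod F hℓ (Finset.mem_filter.1 hγ).2, h, zero_mul]

end InjectiveDensity

/-! ### Concentration of `tInj` around its conditional mean. -/

section SecondMoment

lemma integral_sub_sub_add {α : Type*} [MeasurableSpace α] {μ : Measure α} {f₁ f₂ f₃ f₄ : α → ℝ}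
    (h₁ : Integrable f₁ μ) (h₂ : Integrable f₂ μ) (h₃ : Integrable f₃ μ) (h₄ : Integrable f₄ μ) :
    ∫ x, (f₁ x - f₂ x - f₃ x + f₄ x) ∂μ =
      ∫ x, f₁ x ∂μ - ∫ x, f₂ x ∂μ - ∫ x, f₃ x ∂μ + ∫ x, f₄ x ∂μ := by
  have h₁₂ : Integrable (fun x => f₁ x - f₂ x) μ := h₁.sub h₂
  have h₁₃ : Integrable (fun x => f₁ x - f₂ x - f₃ x) μ := h₁₂.sub h₃
  rw [integral_add h₁₃ h₄, integral_sub h₁₂ h₃, integral_sub h₁ h₂]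

variable {Ω : Type*} [MeasurableSpace Ω] {P : Measure Ω} [IsProbabilityMeasure P]
  {W : Graphon} {X : ℕ → Ω → I} {G : (n : ℕ) → Ω → SimpleGraph (Fin n)}
  {k p n : ℕ} (F : SimpleGraph (Fin p)) {ℓ : Fin k → Fin p}

/-- By `hgood` the two copies meet only in labelled vertices. With the labels on the image of `γ'`
frozen, the unlabelled vertices of `γ` are still free, and `tTilde` is exactly the mean of `zTilde`
over them. -/
lemma integral_extensions_eq_zero (hℓ : Function.Injective ℓ) {α : Fin k → Fin n}
    {γ γ' : Fin p ↪ Fin n} (hγ : ∀ i, γ (ℓ i) = α i) (hγ' : ∀ i, γ' (ℓ i) = α i)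
    (hgood : ¬ ∃ a a', γ a = γ' a' ∧ a ∉ Set.range ℓ) :
    ∫ x : Fin n → I, tHat F ℓ W (fun i => x (α i)) *
      ((zTilde F ℓ W (fun i => x (γ i)) - tTilde F ℓ W fun i => x (α i)) *
        (zTilde F ℓ W (fun i => x (γ' i)) - tTilde F ℓ W fun i => x (α i))) = 0 := by
  have hα : Measurable fun (x : Fin n → I) i => x (α i) := by fun_prop
  have hm : ∀ γ : Fin p ↪ Fin n, Measurable fun (x : Fin n → I) i => x (γ i) := fun γ => by fun_prop
  have hT := (bddMeas_tTilde (ℓ := ℓ) F W).comp hα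
  have hz := fun γ : Fin p ↪ Fin n => (bddMeas_zTilde (ℓ := ℓ) F W).comp (hm γ)
  rw [integral_extend γ'.injective (((bddMeas_tHat (ℓ := ℓ) F W).comp hα).mul
    (((hz γ).sub hT).mul ((hz γ').sub hT)))]
  refine integral_eq_zero_of_ae (.of_forall fun x => ?_)
  have h1 : ∀ y : Fin n → I, (fun i => Function.extend γ' x y (γ' i)) = x := fun y => by
    ext1 i
    exact γ'.injective.extend_apply _ _ _
  have h2 : ∀ y : Fin n → I, (fun i => Function.extend γ' x y (α i)) = fun i => x (ℓ i) :=
    fun y => by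
      ext1 i
      rw [← hγ' i]
      exact γ'.injective.extend_apply _ _ _
  have h3 : ∀ y : Fin n → I, (fun i => Function.extend γ' x y (γ i)) =
      Function.extend ℓ (fun i => x (ℓ i)) (fun i => y (γ i)) := fun y => by
    ext1 j
    by_cases hj : j ∈ Set.range ℓ
    · obtain ⟨i, rfl⟩ := hj
      rw [hℓ.extend_apply, hγ i, ← hγ' i]
      exact γ'.injective.extend_apply _ _ _
    · rw [Function.extend_apply' _ _ _ hj, Function.extend_apply']
      rintro ⟨a, ha⟩
      exact hgood ⟨j, a, ha.symm, hj⟩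
  simp only [h1, h2, h3, Pi.zero_apply]
  rw [integral_const_mul, integral_mul_const,
    integral_precomp γ.injective (φ := fun z => zTilde F ℓ W (Function.extend ℓ (fun i => x (ℓ i)) z)
      - tTilde F ℓ W fun i => x (ℓ i)), integral_sub (integrable_zTilde_extend F W _)
      (integrable_const _)]
  · simp [tTilde]
  · have hext : Measurable fun z : Fin p → I => Function.extend ℓ (fun i => x (ℓ i)) z :=
      (measurable_extend ℓ).comp
        ((measurable_const (a := fun i => x (ℓ i))).prodMk measurable_id)
    exact ((bddMeas_zTilde F W).comp hext).sub (BddMeas.const _)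

/-- The copies share their labelled edges, so their edge products are not conditionally independent.
But `labelledInd` is idempotent: after expansion each of the four terms contains the shared edges
once, and replacing edge indicators by `W` leads to `integral_extensions_eq_zero` with a single
`tHat`. -/
lemma integral_extensions_mul_eq_zero (hG : IsWRandomGraph W P X G) (hℓ : Function.Injective ℓ)
    {α : Fin k → Fin n} {γ γ' : Fin p ↪ Fin n} (hγ : ∀ i, γ (ℓ i) = α i)
    (hγ' : ∀ i, γ' (ℓ i) = α i) (hgood : ¬ ∃ a a', γ a = γ' a' ∧ a ∉ Set.range ℓ) :
    ∫ ω, ((∏ e ∈ edgesAll F, edgeInd (G n ω) (e.map γ)) -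
        labelledInd F ℓ α (G n ω) * tTilde F ℓ W fun i => X (α i) ω) *
      ((∏ e ∈ edgesAll F, edgeInd (G n ω) (e.map γ')) -
        labelledInd F ℓ α (G n ω) * tTilde F ℓ W fun i => X (α i) ω) ∂P = 0 := by
  have hT : BddMeas fun x : Fin n → I => tTilde F ℓ W fun i => x (α i) :=
    (bddMeas_tTilde F W).comp (measurable_pi_lambda _ fun _ => measurable_pi_apply _)
  have hdiagAll : ∀ e ∈ edgesAll F, ¬ e.IsDiag := fun e he =>
    F.not_isDiag_of_mem_edgeSet (mem_edgesAll.1 he)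
  have hdiagIn : ∀ e ∈ edgesIn F ℓ, ¬ e.IsDiag := fun e he =>
    F.not_isDiag_of_mem_edgeSet (mem_edgesIn.1 he).1
  have hdiagOut : ∀ e ∈ edgesOut F ℓ, ¬ e.IsDiag := fun e he =>
    F.not_isDiag_of_mem_edgeSet (mem_edgesOut.1 he).1
  -- An unlabelled end of `e'` is sent by `γ'` outside the image of `γ`.
  have hne : ∀ e : Sym2 (Fin p), ∀ e' ∈ edgesOut F ℓ, e.map γ ≠ e'.map γ' := by
    intro e e' he' heq
    obtain ⟨v', hv', hv'ℓ⟩ : ∃ v ∈ e', v ∉ Set.range ℓ := by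
      simpa using (mem_edgesOut.1 he').2
    have : γ' v' ∈ e.map γ := by
      rw [heq]
      exact Sym2.mem_map.2 ⟨v', hv', rfl⟩
    obtain ⟨v, -, hv⟩ := Sym2.mem_map.1 this
    by_cases h : v ∈ Set.range ℓ
    · obtain ⟨i, rfl⟩ := h
      rw [hγ i, ← hγ' i] at hv
      exact hv'ℓ ⟨i, γ'.injective hv⟩
    · exact hgood ⟨v, v', hv, h⟩
  have key := fun (φ : (Fin n → I) → ℝ) (hφ : BddMeas φ) (A : Finset (Sym2 (Fin p)))
      (hA : ∀ e ∈ A, ¬ e.IsDiag) => hG.integral_mul_prod_two hφ γ γ' A (edgesOut F ℓ) hA hdiagOut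
        (fun e _ => hne e)
  have key' := fun (φ : (Fin n → I) → ℝ) (hφ : BddMeas φ) (A : Finset (Sym2 (Fin p)))
      (hA : ∀ e ∈ A, ¬ e.IsDiag) => hG.integral_mul_prod_two hφ γ γ' A ∅ hA (by simp) (by simp)
  -- The four terms of the expanded product; in `e1` and `e2` the labelled edges are contained in
  -- `edgesAll` of the copy `γ`, in `e3` and `e4` they stand alone.
  have e1 := key _ (BddMeas.const 1) _ hdiagAll
  have e2 := key' _ hT _ hdiagAll
  have e3 := key _ hT _ hdiagIn
  have e4 := key' _ (hT.mul hT) _ hdiagIn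
  have bE : ∀ (A : Finset (Sym2 (Fin p))) (γ : Fin p ↪ Fin n),
      BddMeas fun ω => ∏ e ∈ A, edgeInd (G n ω) (e.map γ) := fun A γ =>
    BddMeas.prod _ fun e _ => hG.bddMeas_graph fun H => edgeInd H (e.map γ)
  have bW : ∀ (A : Finset (Sym2 (Fin p))) (γ : Fin p ↪ Fin n),
      BddMeas fun x : Fin n → I => ∏ e ∈ A, W.edgeVal (fun i => x (γ i)) e := fun A γ =>
    BddMeas.prod _ fun e _ => (BddMeas.edgeVal W e).comp
      (measurable_pi_lambda _ fun _ => measurable_pi_apply _)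
  have bΩ := fun (φ : (Fin n → I) → ℝ) (hφ : BddMeas φ) A B =>
    ((hG.bddMeas_X hφ).mul ((bE A γ).mul (bE B γ'))).integrable P
  have bx := fun (φ : (Fin n → I) → ℝ) (hφ : BddMeas φ) A B =>
    (hφ.mul ((bW A γ).mul (bW B γ'))).integrable volume
  rw [← integral_extensions_eq_zero (W := W) F hℓ hγ hγ' hgood]
  have e := (integral_sub_sub_add (bΩ _ (BddMeas.const 1) _ _) (bΩ _ hT _ _) (bΩ _ hT _ _)
    (bΩ _ (hT.mul hT) _ _)).trans ((congrArg₂ (· + ·) (congrArg₂ (· - ·) (congrArg₂ (· - ·)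
      e1 e2) e3) e4).trans (integral_sub_sub_add (bx _ (BddMeas.const 1) _ _) (bx _ hT _ _)
        (bx _ hT _ _) (bx _ (hT.mul hT) _ _)).symm)
  refine (integral_congr_ae (.of_forall fun ω => ?_)).trans
    (e.trans (integral_congr_ae (.of_forall fun x => ?_)))
  · dsimp only
    rw [← labelledInd_mul_prod F hℓ hγ, ← labelledInd_mul_prod F hℓ hγ',
      ← labelledInd_eq_prod F hℓ hγ, Finset.prod_empty]
    rcases labelledInd_eq F (ℓ := ℓ) α (G n ω) with h | h <;> rw [h] <;> ring
  · have hh := tHat_mul_zTilde F W hℓ (fun i => x (γ i))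
    have hi := tHat_eq_prod F W hℓ (fun i => x (γ i))
    have ho : ∏ e ∈ edgesOut F ℓ, W.edgeVal (fun i => x (γ' i)) e =
      zTilde F ℓ W fun i => x (γ' i) := rfl
    simp only [hγ] at hh hi
    dsimp only
    rw [← hh, ← hi, ho, Finset.prod_empty]
    ring

/-- Given the labels, `tInj` concentrates around its conditional mean. -/
lemma exists_integral_sq_tInj_sub_le (hG : IsWRandomGraph W P X G) (hℓ : Function.Injective ℓ) :
    ∃ C, ∀ n, p ≤ n → k < n → ∀ α : Fin k ↪ Fin n,
      ∫ ω, (tInj F ℓ (G n ω) α -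
        labelledInd F ℓ α (G n ω) * tTilde F ℓ W fun i => X (α i) ω) ^ 2 ∂P ≤ C / n := by
  classical
  -- The factor `p * p` counts the possible coincidences `(a, a')`; `k + 1` comes from `n ≤ (k + 1)
  -- * (n - k)`, valid for `k < n`.
  refine ⟨p * p * (k + 1), fun n hpn hkn α => ?_⟩
  have hkp : k ≤ p := by simpa using Fintype.card_le_of_injective ℓ hℓ
  set s : Finset (Fin p ↪ Fin n) := Finset.univ.filter fun γ => ∀ i, γ (ℓ i) = α i with hs
  have hcard : s.card = (n - k).descFactorial (p - k) := card_filter_extending hℓ α.injective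
  have hMpos : 0 < s.card := by
    rw [hcard]
    exact Nat.pos_of_ne_zero (by rw [Ne, Nat.descFactorial_eq_zero_iff_lt]; omega)
  have hMR : (s.card : ℝ) ≠ 0 := by exact_mod_cast hMpos.ne'
  set Z : (Fin p ↪ Fin n) → Ω → ℝ := fun γ ω => (∏ e ∈ edgesAll F, edgeInd (G n ω) (e.map γ)) -
        labelledInd F ℓ α (G n ω) * tTilde F ℓ W fun i => X (α i) ω with hZ
  have hZb : ∀ γ, BddMeas (Z γ) := fun γ =>
    (hG.bddMeas_graph fun H => ∏ e ∈ edgesAll F, edgeInd H (e.map γ)).sub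
      ((hG.bddMeas_graph fun H => labelledInd F ℓ α H).mul
        (hG.bddMeas_X (φ := fun x => tTilde F ℓ W fun i => x (α i)) ((bddMeas_tTilde F W).comp
          (measurable_pi_lambda _ fun _ => measurable_pi_apply _))))
  have hZ1 : ∀ γ ω, |Z γ ω| ≤ 1 := by
    intro γ ω
    obtain ⟨h1, h2⟩ := prod_edgeInd_mem_Icc (G n ω) (edgesAll F) (Sym2.map γ)
    obtain ⟨h3, h4⟩ := tTilde_mem_Icc F (ℓ := ℓ) W fun i => X (α i) ω
    rw [abs_le]
    rcases labelledInd_eq F (ℓ := ℓ) α (G n ω) with h | h <;> simp only [hZ, h] <;>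
      constructor <;> linarith
  have hsum : ∀ ω, tInj F ℓ (G n ω) α -
      labelledInd F ℓ α (G n ω) * (tTilde F ℓ W fun i => X (α i) ω) =
      (∑ γ ∈ s, Z γ ω) / s.card := by
    intro ω
    rw [hZ, tInj_eq_average, ← hcard, Finset.sum_sub_distrib, Finset.sum_const, nsmul_eq_mul,
      sub_div, mul_div_cancel_left₀ _ hMR]
  simp_rw [hsum]
  have key := fun B => integral_sq_average_le (P := P) (B := B) s (Finset.card_pos.1 hMpos) Z hZb hZ1
    (fun γ γ' => ∃ a a', γ a = γ' a' ∧ a ∉ Set.range ℓ) (fun γ hγ γ' hγ' h =>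
      integral_extensions_mul_eq_zero F hG hℓ (Finset.mem_filter.1 hγ).2
        (Finset.mem_filter.1 hγ').2 h)
  have hn0 : (0 : ℝ) < n := by exact_mod_cast (by omega : 0 < n)
  -- If `k = p` there are no unlabelled vertices, hence no bad pairs.
  rcases hkp.eq_or_lt with rfl | hkp
  · refine (key 0 fun γ _ => ?_).trans ?_
    · rw [Nat.le_zero, Finset.card_eq_zero, Finset.filter_eq_empty_iff]
      rintro γ' - ⟨a, -, -, ha⟩
      exact ha ((Finite.injective_iff_surjective.1 hℓ) a)
    · simp only [Nat.cast_zero, mul_zero, zero_div]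
      positivity
  · refine (key _ fun γ hγ => card_filter_meeting_le hℓ α.injective γ
      (Finset.mem_filter.1 hγ).2).trans ?_
    rw [hcard]
    obtain ⟨m, hm⟩ := Nat.exists_eq_add_of_lt hkn
    obtain ⟨r, hr⟩ := Nat.exists_eq_add_of_lt hkp
    have i1 : n - k = m + 1 := by omega
    have i2 : p - k = r + 1 := by omega
    have i3 : n - (k + 1) = m := by omega
    have i4 : p - (k + 1) = r := by omega
    have hD : (0 : ℝ) < m.descFactorial r := by
      exact_mod_cast Nat.pos_of_ne_zero (by
        rw [Ne, Nat.descFactorial_eq_zero_iff_lt]; omega)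
    rw [i1, i2, i3, i4, Nat.succ_descFactorial_succ]
    push_cast
    rw [div_le_div_iff₀ (by positivity) hn0, one_pow, one_mul]
    have h1 : (n : ℝ) ≤ (k + 1) * (m + 1) := by
      have : n ≤ (k + 1) * (m + 1) := by rw [hm]; ring_nf; nlinarith
      exact_mod_cast this
    have h2 : 0 ≤ (p : ℝ) * p * m.descFactorial r := by positivity
    nlinarith [mul_le_mul_of_nonneg_left h1 h2]

end SecondMoment

/-! ### First-order Taylor expansion on the cube. -/

section Taylor

variable {d : ℕ} {g : (Fin d → ℝ) → ℝ}

lemma convex_cube (d : ℕ) : Convex ℝ (cube d) := convex_Icc _ _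

lemma isCompact_cube (d : ℕ) : IsCompact (cube d) := isCompact_Icc

lemma uniqueDiffOn_cube (d : ℕ) : UniqueDiffOn ℝ (cube d) := by
  rw [cube, ← Set.pi_univ_Icc]
  exact UniqueDiffOn.univ_pi fun _ => uniqueDiffOn_Icc zero_lt_one

lemma continuousOn_gradCube (hg : ContDiffOn ℝ 2 g (cube d)) (m : Fin d) :
    ContinuousOn (fun z => gradCube g z m) (cube d) :=
  (hg.continuousOn_fderivWithin (uniqueDiffOn_cube d) (by norm_num)).clm_apply continuousOn_const

/-- The second derivative is bounded on the compact convex cube, so the derivative is Lipschitz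
there, and the mean value inequality on the segment from `s` to `t` gives a quadratic error. -/
lemma exists_taylor_bound (hg : ContDiffOn ℝ 2 g (cube d)) :
    ∃ K : ℝ, 0 ≤ K ∧ ∀ s ∈ cube d, ∀ t ∈ cube d,
      |g t - g s - ∑ m, gradCube g s m * (t m - s m)| ≤ K * ∑ m, (t m - s m) ^ 2 := by
  have h1 : ContDiffOn ℝ 1 (fderivWithin ℝ g (cube d)) (cube d) :=
    hg.fderivWithin (uniqueDiffOn_cube d) (by norm_num)
  have hc : ContinuousOn (fderivWithin ℝ (fderivWithin ℝ g (cube d)) (cube d)) (cube d) :=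
    h1.continuousOn_fderivWithin (uniqueDiffOn_cube d) le_rfl
  obtain ⟨K, hK⟩ := IsCompact.exists_bound_of_continuousOn
    (E := (Fin d → ℝ) →L[ℝ] (Fin d → ℝ) →L[ℝ] ℝ) (isCompact_cube d) hc
  have hzero : (0 : Fin d → ℝ) ∈ cube d := Set.left_mem_Icc.2 zero_le_one
  have hK0 : 0 ≤ K := (norm_nonneg _).trans (hK 0 hzero)
  have hlip : ∀ x ∈ cube d, ∀ y ∈ cube d,
      ‖fderivWithin ℝ g (cube d) y - fderivWithin ℝ g (cube d) x‖ ≤ K * ‖y - x‖ := fun x hx y hy =>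
    (convex_cube d).norm_image_sub_le_of_norm_fderivWithin_le
      (h1.differentiableOn one_ne_zero) hK hx hy
  refine ⟨K, hK0, fun s hs t ht => ?_⟩
  have hseg : segment ℝ s t ⊆ cube d := (convex_cube d).segment_subset hs ht
  have h2 := (convex_segment s t).norm_image_sub_le_of_norm_hasFDerivWithin_le'
    (f := g) (f' := fderivWithin ℝ g (cube d)) (φ := fderivWithin ℝ g (cube d) s)
    (C := K * ‖t - s‖)
    (fun x hx => ((hg.differentiableOn two_ne_zero x (hseg hx)).hasFDerivWithinAt).mono hseg)
    (fun x hx => (hlip s hs x (hseg hx)).trans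
      (mul_le_mul_of_nonneg_left (norm_sub_le_of_mem_segment hx) hK0))
    (left_mem_segment ℝ s t) (right_mem_segment ℝ s t)
  have h3 : fderivWithin ℝ g (cube d) s (t - s) = ∑ m, gradCube g s m * (t m - s m) := by
    rw [← ContinuousLinearMap.coe_coe, LinearMap.pi_apply_eq_sum_univ]
    refine Finset.sum_congr rfl fun m _ => ?_
    have hs : (fun j => if m = j then (1 : ℝ) else 0) = Pi.single m 1 := by
      ext j
      simp [Pi.single_apply, eq_comm]
    rw [smul_eq_mul, mul_comm, gradCube, Pi.sub_apply, hs]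
    rfl
  rw [h3, Real.norm_eq_abs] at h2
  refine h2.trans ?_
  rw [mul_assoc, ← pow_two]
  refine mul_le_mul_of_nonneg_left ?_ hK0
  -- The norm is the sup norm, which is at most the Euclidean one.
  rw [← Real.le_sqrt (norm_nonneg _) (Finset.sum_nonneg fun _ _ => sq_nonneg _),
    pi_norm_le_iff_of_nonneg (Real.sqrt_nonneg _)]
  intro m
  rw [Real.norm_eq_abs]
  exact Real.abs_le_sqrt (Finset.single_le_sum (f := fun m => (t m - s m) ^ 2)
    (fun _ _ => sq_nonneg _) (Finset.mem_univ m))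

lemma BddMeas.comp_of_continuousOn_cube {α : Type*} [MeasurableSpace α] {φ : (Fin d → ℝ) → ℝ}
    (hφ : ContinuousOn φ (cube d)) {f : α → Fin d → ℝ} (hf : Measurable f)
    (hfc : ∀ x, f x ∈ cube d) : BddMeas fun x => φ (f x) := by
  obtain ⟨C, hC⟩ := (isCompact_cube d).exists_bound_of_continuousOn hφ
  exact ⟨(continuousOn_iff_continuous_domRestrict.1 hφ).measurable.comp
    (hf.subtype_mk (h := hfc)), C, fun x => hC _ (hfc x)⟩

end Taylor

/-! ### The linearized kernel: its mean and its projections. -/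

section Kernel

variable {d k p : ℕ} (F : Fin d → SimpleGraph (Fin p)) (ℓ : Fin k → Fin p) (W : Graphon)
  {g : (Fin d → ℝ) → ℝ}

lemma tTildeVec_mem_cube (x : Fin k → I) : tTildeVec F ℓ W x ∈ cube d :=
  ⟨fun m => (tTilde_mem_Icc (F m) W x).1, fun m => (tTilde_mem_Icc (F m) W x).2⟩

lemma measurable_tTildeVec : Measurable (tTildeVec F ℓ W) :=
  measurable_pi_lambda _ fun m => (bddMeas_tTilde (F m) W).measurable

lemma bddMeas_comp_tTildeVec {φ : (Fin d → ℝ) → ℝ} (hφ : ContinuousOn φ (cube d)) :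
    BddMeas fun x => φ (tTildeVec F ℓ W x) :=
  .comp_of_continuousOn_cube hφ (measurable_tTildeVec F ℓ W) (tTildeVec_mem_cube F ℓ W)

/-- The value at `x` of `g - g 0 - ⟨·, ∇g⟩`. -/
noncomputable def constPart (g : (Fin d → ℝ) → ℝ) (x : Fin k → I) : ℝ :=
  g (tTildeVec F ℓ W x) - g 0 - ∑ m, gradCube g (tTildeVec F ℓ W x) m * tTilde (F m) ℓ W x

lemma bddMeas_constPart (hg : ContDiffOn ℝ 2 g (cube d)) : BddMeas (constPart F ℓ W g) :=
  ((bddMeas_comp_tTildeVec F ℓ W hg.continuousOn).sub (BddMeas.const _)).sub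
    (BddMeas.sum _ fun m _ => (bddMeas_comp_tTildeVec F ℓ W (continuousOn_gradCube hg m)).mul
      (bddMeas_tTilde (F m) W))

variable [NeZero d]

/-- The linearization of `g (tInj (F^ℓ, G^α))` around the conditional means. -/
noncomputable def linKernel (hg : ContDiffOn ℝ 2 g (cube d)) :
    EdgeKernel p (Option (Option (Fin d))) where
  coef
    | none => fun _ => g 0
    | some none => fun y => constPart F ℓ W g fun i => y (ℓ i)
    | some (some m) => fun y => gradCube g (tTildeVec F ℓ W fun i => y (ℓ i)) m
  edges
    | none => ∅
    -- Under `SameLabelledEdges` any index could replace 0.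
    | some none => edgesIn (F 0) ℓ
    | some (some m) => edgesAll (F m)
  bddMeas_coef
    | none => BddMeas.const _
    | some none => (bddMeas_constPart F ℓ W hg).comp
        (measurable_pi_lambda _ fun _ => measurable_pi_apply _)
    | some (some m) => (bddMeas_comp_tTildeVec F ℓ W (continuousOn_gradCube hg m)).comp
        (measurable_pi_lambda _ fun _ => measurable_pi_apply _)
  not_isDiag
    | none => by simp
    | some none => fun _ he => (F 0).not_isDiag_of_mem_edgeSet (mem_edgesIn.1 he).1
    | some (some m) => fun _ he => (F m).not_isDiag_of_mem_edgeSet (mem_edgesAll.1 he)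

variable {F ℓ}

lemma linKernel_mean_extend (hg : ContDiffOn ℝ 2 g (cube d)) (hℓ : Function.Injective ℓ)
    (x : Fin k → I) (y : Fin p → I) :
    (linKernel F ℓ W hg).mean W (Function.extend ℓ x y) =
      g 0 + tHat (F 0) ℓ W x * constPart F ℓ W g x + ∑ m, gradCube g (tTildeVec F ℓ W x) m *
        (tHat (F m) ℓ W x * zTilde (F m) ℓ W (Function.extend ℓ x y)) := by
  have hx : (fun i => Function.extend ℓ x y (ℓ i)) = x := by
    ext1 i
    exact hℓ.extend_apply _ _ _
  rw [EdgeKernel.mean, Fintype.sum_option, Fintype.sum_option]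
  simp only [linKernel, Finset.prod_empty, ← tHat_eq_prod _ W hℓ, ← tHat_mul_zTilde _ W hℓ, hx]
  ring

/-- Averaging `zTilde` over the unlabelled labels gives `tTilde`, so the gradient terms cancel those
subtracted in `constPart`. The common value of `tHat` is needed for this. -/
lemma integral_linKernel_mean_extend (hg : ContDiffOn ℝ 2 g (cube d)) (hℓ : Function.Injective ℓ)
    (hF : SameLabelledEdges F ℓ) (x : Fin k → I) :
    ∫ y, (linKernel F ℓ W hg).mean W (Function.extend ℓ x y) =
      g 0 + tHat (F 0) ℓ W x * (g (tTildeVec F ℓ W x) - g 0) := by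
  have hz := fun m => (((integrable_zTilde_extend (F m) (ℓ := ℓ) W x).const_mul
    (tHat (F m) ℓ W x)).const_mul (gradCube g (tTildeVec F ℓ W x) m))
  simp_rw [linKernel_mean_extend W hg hℓ]
  rw [integral_add (integrable_const _) (integrable_finsetSum _ fun m _ => hz m),
    integral_finsetSum _ fun m _ => hz m]
  simp_rw [integral_const_mul]
  simp only [integral_const, probReal_univ, one_smul, constPart]
  have : ∀ m, tHat (F m) ℓ W x = tHat (F 0) ℓ W x := fun m =>
    tHat_congr W (hF.comap_eq m 0) x
  simp only [this, mul_sub, Finset.mul_sum]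
  have h2 : ∀ m, ∫ y : Fin p → I, zTilde (F m) ℓ W (Function.extend ℓ x y) = tTilde (F m) ℓ W x :=
    fun m => rfl
  simp only [h2, mul_left_comm (gradCube _ _ _)]
  ring

lemma integral_linKernel_mean (hg : ContDiffOn ℝ 2 g (cube d)) (hℓ : Function.Injective ℓ)
    (hF : SameLabelledEdges F ℓ) :
    ∫ x, (linKernel F ℓ W hg).mean W x = gammaLim F ℓ W g := by
  have hH := bddMeas_tHat (F 0) (ℓ := ℓ) W
  have hgT := bddMeas_comp_tTildeVec F ℓ W hg.continuousOn
  rw [integral_extend hℓ ((linKernel F ℓ W hg).bddMeas_mean W)]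
  simp_rw [integral_linKernel_mean_extend W hg hℓ hF, mul_sub]
  rw [integral_add (integrable_const _)
      (((hH.mul hgT).sub (hH.mul (BddMeas.const _))).integrable _),
    integral_sub ((hH.mul hgT).integrable _) ((hH.mul (BddMeas.const _)).integrable _),
    integral_mul_const, gammaLim]
  simp only [integral_const, probReal_univ, one_smul]
  ring

lemma linKernel_proj_labelled (hg : ContDiffOn ℝ 2 g (cube d)) (hℓ : Function.Injective ℓ)
    (hF : SameLabelledEdges F ℓ) (i : Fin k) (u : I) :
    (linKernel F ℓ W hg).proj W (ℓ i) u =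
      g 0 + ∫ x : Fin k → I, tHat (F 0) ℓ W (Function.update x i u) *
        (g (tTildeVec F ℓ W (Function.update x i u)) - g 0) := by
  have hup : Measurable fun z : Fin p → I => Function.update z (ℓ i) u :=
    measurable_update'.comp (measurable_id.prodMk measurable_const)
  have hup' : Measurable fun z : Fin k → I => Function.update z i u :=
    measurable_update'.comp (measurable_id.prodMk measurable_const)
  rw [EdgeKernel.proj, integral_extend hℓ (((linKernel F ℓ W hg).bddMeas_mean W).comp hup)]
  have hcomm : ∀ (x : Fin k → I) (y : Fin p → I), Function.update (Function.extend ℓ x y) (ℓ i) u =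
      Function.extend ℓ (Function.update x i u) y := by
    intro x y
    ext1 j
    by_cases hj : j ∈ Set.range ℓ
    · obtain ⟨i', rfl⟩ := hj
      rw [hℓ.extend_apply]
      by_cases h : i' = i
      · subst h; simp
      · rw [Function.update_of_ne h, Function.update_of_ne (hℓ.ne h), hℓ.extend_apply]
    · rw [Function.extend_apply' _ _ _ hj, Function.update_of_ne (fun h => hj ⟨i, h.symm⟩),
        Function.extend_apply' _ _ _ hj]
  simp_rw [hcomm, integral_linKernel_mean_extend W hg hℓ hF]
  rw [integral_add (integrable_const _)]
  · simp
  · exact (((bddMeas_tHat (F 0) W).mul ((bddMeas_comp_tTildeVec F ℓ W hg.continuousOn).sub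
      (BddMeas.const _))).comp hup').integrable _

/-- Adding `q` to the labelled word moves the edges between `q` and `ℓ` from `zTilde` to `tHat`;
both sides integrate the same product over all edges of `f`. -/
lemma tHat_mul_integral_zTilde_update (f : SimpleGraph (Fin p)) (hℓ : Function.Injective ℓ)
    {q : Fin p} (hq : q ∉ Set.range ℓ) (x : Fin k → I) (u : I) :
    tHat f ℓ W x * ∫ y : Fin p → I, zTilde f ℓ W (Function.extend ℓ x (Function.update y q u)) =
      tLab f (Fin.snoc ℓ q : Fin (k + 1) → Fin p) W (Fin.snoc x u : Fin (k + 1) → I) := by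
  have hinj : Function.Injective (Fin.snoc ℓ q : Fin (k + 1) → Fin p) :=
    Fin.snoc_injective_iff.2 ⟨hℓ, hq⟩
  have hext : ∀ y : Fin p → I, Function.extend ℓ x (Function.update y q u) =
      Function.extend (Fin.snoc ℓ q : Fin (k + 1) → Fin p) (Fin.snoc x u : Fin (k + 1) → I) y := by
    intro y
    ext1 j
    by_cases hj : j ∈ Set.range ℓ
    · obtain ⟨i, rfl⟩ := hj
      have := hinj.extend_apply (Fin.snoc x u : Fin (k + 1) → I) y i.castSucc
      rw [Fin.snoc_castSucc, Fin.snoc_castSucc] at this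
      rw [this, hℓ.extend_apply]
    · rw [Function.extend_apply' _ _ _ hj]
      by_cases hjq : j = q
      · subst hjq
        have := hinj.extend_apply (Fin.snoc x u : Fin (k + 1) → I) y (Fin.last k)
        rw [Fin.snoc_last, Fin.snoc_last] at this
        rw [this, Function.update_self]
      · rw [Function.update_of_ne hjq, Function.extend_apply']
        rintro ⟨i, hi⟩
        induction i using Fin.lastCases with
        | last => rw [Fin.snoc_last] at hi; exact hjq hi.symm
        | cast i => rw [Fin.snoc_castSucc] at hi; exact hj ⟨i, hi⟩
  rw [tLab, tTilde, ← integral_const_mul, ← integral_const_mul]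
  refine integral_congr_ae (.of_forall fun y => ?_)
  dsimp only
  have h1 := tHat_mul_zTilde f W hℓ (Function.extend ℓ x (Function.update y q u))
  have h2 := tHat_mul_zTilde f W hinj (Function.extend (Fin.snoc ℓ q : Fin (k + 1) → Fin p)
    (Fin.snoc x u : Fin (k + 1) → I) y)
  have h3 : (fun i => Function.extend ℓ x (Function.update y q u) (ℓ i)) = x := by
    ext1 i
    exact hℓ.extend_apply _ _ _
  have h4 : (fun i => Function.extend (Fin.snoc ℓ q : Fin (k + 1) → Fin p)
      (Fin.snoc x u : Fin (k + 1) → I) y ((Fin.snoc ℓ q : Fin (k + 1) → Fin p) i)) =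
      (Fin.snoc x u : Fin (k + 1) → I) := by
    ext1 i
    exact hinj.extend_apply _ _ _
  rw [h3] at h1
  rw [h4] at h2
  rw [h1, h2, hext]

lemma bddMeas_tLab {r : ℕ} (f : SimpleGraph (Fin p)) (lam : Fin r → Fin p) :
    BddMeas (tLab f lam W) := (bddMeas_tHat f W).mul (bddMeas_tTilde f W)

/-- The label of an unlabelled vertex enters only through the edge products multiplied by the
gradient; the rest is a constant, which centring removes. -/
lemma linKernel_proj_unlabelled (hg : ContDiffOn ℝ 2 g (cube d)) (hℓ : Function.Injective ℓ)
    {q : Fin p} (hq : q ∉ Set.range ℓ) (u : I) :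
    (linKernel F ℓ W hg).proj W q u =
      (∫ x : Fin k → I, (g 0 + tHat (F 0) ℓ W x * constPart F ℓ W g x)) +
      ∫ x : Fin k → I, ∑ m : Fin d, tLab (F m) (Fin.snoc ℓ q : Fin (k + 1) → Fin p) W
        (Fin.snoc x u : Fin (k + 1) → I) * gradCube g (tTildeVec F ℓ W x) m := by
  have hup : Measurable fun z : Fin p → I => Function.update z q u :=
    measurable_update'.comp (measurable_id.prodMk measurable_const)
  have hsnoc : Measurable fun x : Fin k → I => (Fin.snoc x u : Fin (k + 1) → I) := by
    refine measurable_pi_lambda _ fun i => ?_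
    induction i using Fin.lastCases with
    | last => simp
    | cast i => simpa using measurable_pi_apply i
  rw [EdgeKernel.proj, integral_extend hℓ (((linKernel F ℓ W hg).bddMeas_mean W).comp hup)]
  have hcomm : ∀ (x : Fin k → I) (y : Fin p → I), Function.update (Function.extend ℓ x y) q u =
      Function.extend ℓ x (Function.update y q u) := by
    intro x y
    ext1 j
    by_cases hj : j ∈ Set.range ℓ
    · obtain ⟨i, rfl⟩ := hj
      rw [hℓ.extend_apply, Function.update_of_ne (fun h => hq ⟨i, h⟩), hℓ.extend_apply]
    · rw [Function.extend_apply' _ _ _ hj]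
      by_cases h : j = q
      · subst h; simp
      · rw [Function.update_of_ne h, Function.update_of_ne h, Function.extend_apply' _ _ _ hj]
  have hinner : ∀ x : Fin k → I, ∫ y : Fin p → I,
      (linKernel F ℓ W hg).mean W (Function.extend ℓ x (Function.update y q u)) =
      (g 0 + tHat (F 0) ℓ W x * constPart F ℓ W g x) +
        ∑ m : Fin d, tLab (F m) (Fin.snoc ℓ q : Fin (k + 1) → Fin p) W
          (Fin.snoc x u : Fin (k + 1) → I) * gradCube g (tTildeVec F ℓ W x) m := by
    intro x
    have hex : Measurable fun y : Fin p → I => Function.extend ℓ x (Function.update y q u) :=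
      (measurable_extend ℓ).comp ((measurable_const (a := x)).prodMk hup)
    have hz := fun m => (((((bddMeas_zTilde (F m) (ℓ := ℓ) W).comp hex).integrable
      volume).const_mul (tHat (F m) ℓ W x)).const_mul (gradCube g (tTildeVec F ℓ W x) m))
    simp_rw [linKernel_mean_extend W hg hℓ]
    rw [integral_add (integrable_const _) (integrable_finsetSum _ fun m _ => hz m),
      integral_finsetSum _ fun m _ => hz m]
    simp_rw [integral_const_mul, tHat_mul_integral_zTilde_update W _ hℓ hq]
    simp only [integral_const, probReal_univ, one_smul]
    congr 1
    exact Finset.sum_congr rfl fun m _ => mul_comm _ _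
  simp_rw [hcomm, hinner]
  refine integral_add (((BddMeas.const _).add ((bddMeas_tHat (F 0) W).mul
    (bddMeas_constPart F ℓ W hg))).integrable _) ((BddMeas.sum _ fun m _ => ?_).integrable _)
  exact ((bddMeas_tLab W _ _).comp hsnoc).mul
    (bddMeas_comp_tTildeVec F ℓ W (continuousOn_gradCube hg m))

lemma exists_sum_linKernel_proj_eq (hg : ContDiffOn ℝ 2 g (cube d)) (hℓ : Function.Injective ℓ)
    (hF : SameLabelledEdges F ℓ) :
    ∃ c, ∀ u, ∑ q, (linKernel F ℓ W hg).proj W q u = uVar F ℓ W g u + c := by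
  classical
  refine ⟨∑ i : Fin k, g 0 + ∑ q : Fin p with q ∉ Set.range ℓ,
    ∫ x : Fin k → I, (g 0 + tHat (F 0) ℓ W x * constPart F ℓ W g x), fun u => ?_⟩
  rw [← Finset.sum_filter_add_sum_filter_not Finset.univ (fun q => q ∈ Set.range ℓ), uVar]
  have h1 : ∑ q : Fin p with q ∈ Set.range ℓ, (linKernel F ℓ W hg).proj W q u =
      ∑ i, (linKernel F ℓ W hg).proj W (ℓ i) u := by
    rw [← Finset.sum_image (f := fun q => (linKernel F ℓ W hg).proj W q u) (g := ℓ) hℓ.injOn]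
    refine Finset.sum_congr ?_ fun _ _ => rfl
    ext q
    simp
  rw [h1, Finset.sum_congr rfl fun i _ => linKernel_proj_labelled W hg hℓ hF i u,
    Finset.sum_congr rfl fun q hq => linKernel_proj_unlabelled W hg hℓ
      (Finset.mem_filter.1 hq).2 u, Finset.sum_add_distrib, Finset.sum_add_distrib]
  rw [add_add_add_comm, add_comm]

lemma bddMeas_uVar (hg : ContDiffOn ℝ 2 g (cube d)) (hℓ : Function.Injective ℓ)
    (hF : SameLabelledEdges F ℓ) : BddMeas (uVar F ℓ W g) := by
  obtain ⟨c, hc⟩ := exists_sum_linKernel_proj_eq W hg hℓ hF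
  have : uVar F ℓ W g = fun u => ∑ q, (linKernel F ℓ W hg).proj W q u - c := by
    ext u
    rw [hc u]
    ring
  rw [this]
  exact (BddMeas.sum _ fun q _ => (linKernel F ℓ W hg).bddMeas_proj W q).sub (BddMeas.const c)

lemma sum_linKernel_proj_sub (hg : ContDiffOn ℝ 2 g (cube d)) (hℓ : Function.Injective ℓ)
    (hF : SameLabelledEdges F ℓ) (u : I) :
    ∑ q, ((linKernel F ℓ W hg).proj W q u - ∫ x, (linKernel F ℓ W hg).mean W x) =
      uVar F ℓ W g u - ∫ v, uVar F ℓ W g v := by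
  obtain ⟨c, hc⟩ := exists_sum_linKernel_proj_eq W hg hℓ hF
  have h1 : (∫ v, uVar F ℓ W g v) + c =
      ∑ q : Fin p, ∫ x, (linKernel F ℓ W hg).mean W x := by
    rw [Finset.sum_congr rfl fun q _ => ((linKernel F ℓ W hg).integral_proj W q).symm]
    rw [← integral_finsetSum _ fun q _ => ((linKernel F ℓ W hg).bddMeas_proj W q).integrable _]
    simp_rw [hc]
    rw [integral_add ((bddMeas_uVar W hg hℓ hF).integrable _) (integrable_const _)]
    simp
  rw [Finset.sum_sub_distrib, hc, ← h1]
  ring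

end Kernel

/-! ### Replacing `gammaN` by the average of the linearized kernel. -/

section Approximation

variable {Ω : Type*} [MeasurableSpace Ω] {P : Measure Ω} [IsProbabilityMeasure P]
  {W : Graphon} {X : ℕ → Ω → I} {G : (n : ℕ) → Ω → SimpleGraph (Fin n)}
  {d k p : ℕ} [NeZero d] {F : Fin d → SimpleGraph (Fin p)} {ℓ : Fin k → Fin p}
  {g : (Fin d → ℝ) → ℝ}

/-- The coefficients depend only on the labels of `α = γ ∘ ℓ`, so averaging over the extensions `γ`
of `α` turns the full edge products into `tInj`. -/
lemma linKernel_average (hg : ContDiffOn ℝ 2 g (cube d)) (hℓ : Function.Injective ℓ) {n : ℕ}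
    (hpn : p ≤ n) (x : Fin n → I) (H : SimpleGraph (Fin n)) :
    (∑ γ : Fin p ↪ Fin n, (linKernel F ℓ W hg).eval γ x H) / Fintype.card (Fin p ↪ Fin n) =
      (∑ α : Fin k ↪ Fin n, (g 0 + labelledInd (F 0) ℓ α H * constPart F ℓ W g (fun i => x (α i)) +
        ∑ m, gradCube g (tTildeVec F ℓ W fun i => x (α i)) m * tInj (F m) ℓ H α)) /
        Fintype.card (Fin k ↪ Fin n) := by
  classical
  have hkp : k ≤ p := by simpa using Fintype.card_le_of_injective ℓ hℓ
  have hM : ((n - k).descFactorial (p - k) : ℝ) ≠ 0 := by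
    have : (n - k).descFactorial (p - k) ≠ 0 := by
      rw [Ne, Nat.descFactorial_eq_zero_iff_lt]; omega
    exact_mod_cast this
  rw [← average_extending hℓ (fun _ γ => (linKernel F ℓ W hg).eval γ x H)]
  congr 1
  refine Finset.sum_congr rfl fun α _ => ?_
  have hcard := card_filter_extending hℓ α.injective
  have heval : ∀ γ ∈ (Finset.univ.filter fun γ : Fin p ↪ Fin n => ∀ i, γ (ℓ i) = α i),
      (linKernel F ℓ W hg).eval γ x H =
        g 0 + labelledInd (F 0) ℓ α H * constPart F ℓ W g (fun i => x (α i)) +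
        ∑ m, gradCube g (tTildeVec F ℓ W fun i => x (α i)) m *
          ∏ e ∈ edgesAll (F m), edgeInd H (e.map γ) := by
    intro γ hγ
    replace hγ := (Finset.mem_filter.1 hγ).2
    rw [EdgeKernel.eval, Fintype.sum_option, Fintype.sum_option]
    simp only [linKernel, Finset.prod_empty, hγ, labelledInd_eq_prod (F 0) hℓ hγ]
    ring
  rw [Finset.sum_congr rfl heval, Finset.sum_add_distrib, Finset.sum_const, hcard, nsmul_eq_mul,
    add_div, mul_div_cancel_left₀ _ hM, Finset.sum_comm, Finset.sum_div]
  congr 1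
  refine Finset.sum_congr rfl fun m _ => ?_
  rw [← Finset.mul_sum, mul_div_assoc, tInj_eq_average]

/-- If a labelled edge is missing, every `tInj` vanishes and the linearization is exactly `g 0`.
Otherwise it is the Taylor polynomial at `tTildeVec`, and the bound `hK` applies. -/
lemma abs_sub_linearization_le {K : ℝ} (hℓ : Function.Injective ℓ) (hF : SameLabelledEdges F ℓ)
    (hK : ∀ s ∈ cube d, ∀ t ∈ cube d,
      |g t - g s - ∑ m, gradCube g s m * (t m - s m)| ≤ K * ∑ m, (t m - s m) ^ 2)
    {n : ℕ} (α : Fin k ↪ Fin n) (x : Fin k → I) (H : SimpleGraph (Fin n)) :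
    |g (fun m => tInj (F m) ℓ H α) - (g 0 + labelledInd (F 0) ℓ α H * constPart F ℓ W g x +
        ∑ m, gradCube g (tTildeVec F ℓ W x) m * tInj (F m) ℓ H α)| ≤
      K * ∑ m, (tInj (F m) ℓ H α - labelledInd (F m) ℓ α H * tTilde (F m) ℓ W x) ^ 2 := by
  have hY : ∀ m, labelledInd (F m) ℓ α H = labelledInd (F 0) ℓ α H := fun m =>
    labelledInd_congr (hF.comap_eq m 0) α H
  simp only [hY]
  rcases labelledInd_eq (F 0) (ℓ := ℓ) α H with h | h
  · have ht : ∀ m, tInj (F m) ℓ H α = 0 := fun m => tInj_eq_zero (F m) hℓ ((hY m).trans h)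
    simp only [ht, h, mul_zero, zero_mul, Finset.sum_const_zero, add_zero]
    rw [show (fun _ : Fin d => (0 : ℝ)) = 0 from rfl]
    simp
  · have := hK _ (tTildeVec_mem_cube F ℓ W x) (fun m => tInj (F m) ℓ H α)
      ⟨fun m => (tInj_mem_Icc (F m) hℓ H α.injective).1,
        fun m => (tInj_mem_Icc (F m) hℓ H α.injective).2⟩
    simp only [h, one_mul]
    refine le_of_eq_of_le ?_ this
    congr 1
    simp only [constPart, tTildeVec, mul_sub, Finset.sum_sub_distrib]
    ring

lemma exists_integral_abs_gammaN_sub_le (hG : IsWRandomGraph W P X G) (hℓ : Function.Injective ℓ)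
    (hF : SameLabelledEdges F ℓ) (hg : ContDiffOn ℝ 2 g (cube d)) :
    ∃ C, ∀ n, p ≤ n → k < n →
      ∫ ω, |gammaN F ℓ g (G n ω) - (∑ γ : Fin p ↪ Fin n,
        (linKernel F ℓ W hg).eval γ (fun i => X i ω) (G n ω)) /
          Fintype.card (Fin p ↪ Fin n)| ∂P ≤ C / n := by
  obtain ⟨K, hK0, hK⟩ := exists_taylor_bound hg
  choose C hC using fun m => exists_integral_sq_tInj_sub_le (F m) hG hℓ
  refine ⟨K * ∑ m, C m, fun n hpn hkn => ?_⟩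
  have hN : (0 : ℝ) < Fintype.card (Fin k ↪ Fin n) := by
    have : Nonempty (Fin k ↪ Fin n) := ⟨Fin.castLEEmb hkn.le⟩
    exact_mod_cast Fintype.card_pos
  set D : (Fin k ↪ Fin n) → Fin d → Ω → ℝ := fun α m ω => (tInj (F m) ℓ (G n ω) α -
    labelledInd (F m) ℓ α (G n ω) * tTilde (F m) ℓ W fun i => X (α i) ω) ^ 2 with hD
  have hDb : ∀ α m, BddMeas (D α m) := fun α m =>
    ((hG.bddMeas_graph fun H => tInj (F m) ℓ H α).sub
      ((hG.bddMeas_graph fun H => labelledInd (F m) ℓ α H).mul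
        (hG.bddMeas_X (φ := fun x => tTilde (F m) ℓ W fun i => x (α i))
          ((bddMeas_tTilde (F m) W).comp
            (measurable_pi_lambda _ fun _ => measurable_pi_apply _))))).sq
  have hSb : BddMeas fun ω => (∑ α : Fin k ↪ Fin n, K * ∑ m, D α m ω) /
      Fintype.card (Fin k ↪ Fin n) := by
    simp only [div_eq_mul_inv]
    exact (BddMeas.sum _ fun α _ => (BddMeas.const _).mul
      (BddMeas.sum _ fun m _ => hDb α m)).mul (BddMeas.const _)
  have hbound : ∀ ω, |gammaN F ℓ g (G n ω) - (∑ γ : Fin p ↪ Fin n,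
        (linKernel F ℓ W hg).eval γ (fun i => X i ω) (G n ω)) /
          Fintype.card (Fin p ↪ Fin n)| ≤
      (∑ α : Fin k ↪ Fin n, K * ∑ m, D α m ω) / Fintype.card (Fin k ↪ Fin n) := by
    intro ω
    rw [linKernel_average hg hℓ hpn, gammaN, ← sub_div, ← Finset.sum_sub_distrib, abs_div,
      abs_of_pos hN]
    refine div_le_div_of_nonneg_right ?_ hN.le
    refine (Finset.abs_sum_le_sum_abs _ _).trans (Finset.sum_le_sum fun α _ => ?_)
    exact abs_sub_linearization_le hℓ hF hK α (fun i => X (α i) ω) (G n ω)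
  refine (integral_mono_of_nonneg (.of_forall fun ω => abs_nonneg _) (hSb.integrable P)
    (.of_forall hbound)).trans ?_
  rw [integral_div, div_le_iff₀ hN, integral_finsetSum _ fun α _ =>
    ((BddMeas.const K).mul (BddMeas.sum _ fun m _ => hDb α m)).integrable P]
  refine (Finset.sum_le_card_nsmul _ _ (K * (∑ m, C m) / n) fun α _ => ?_).trans
    (le_of_eq ?_)
  · rw [integral_const_mul, integral_finsetSum _ fun m _ => (hDb α m).integrable P, mul_div_assoc,
      Finset.sum_div]
    exact mul_le_mul_of_nonneg_left (Finset.sum_le_sum fun m _ => hC m n hpn hkn α) hK0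
  · rw [Finset.card_univ, nsmul_eq_mul, mul_comm]

end Approximation

/-! ### Passage to the limit in distribution. -/

lemma tendstoInMeasure_zero_of_integral_abs_le {Ω : Type*} [MeasurableSpace Ω] {P : Measure Ω}
    [IsProbabilityMeasure P] {f : ℕ → Ω → ℝ} (hf : ∀ n, BddMeas (f n)) {b : ℕ → ℝ}
    (hb : Tendsto b atTop (nhds 0)) (hfb : ∀ᶠ n in atTop, ∫ ω, |f n ω| ∂P ≤ b n) :
    TendstoInMeasure P f atTop 0 := by
  refine tendstoInMeasure_of_tendsto_eLpNorm (p := 1) one_ne_zero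
    (fun n => (hf n).measurable.aestronglyMeasurable) aestronglyMeasurable_zero ?_
  have h1 : ∀ n, eLpNorm (f n - 0) 1 P = ENNReal.ofReal (∫ ω, |f n ω| ∂P) := fun n => by
    rw [sub_zero, eLpNorm_one_eq_lintegral_enorm,
      ← ofReal_integral_norm_eq_lintegral_enorm ((hf n).integrable P)]
    rfl
  simp_rw [h1]
  rw [← ENNReal.ofReal_zero]
  refine (ENNReal.continuous_ofReal.tendsto 0).comp
    (tendsto_of_tendsto_of_tendsto_of_le_of_le' tendsto_const_nhds hb
      (.of_forall fun n => integral_nonneg fun ω => abs_nonneg _) hfb)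

/-- The central limit theorem for functions of the `X i` of a `W`-random graph. -/
lemma IsWRandomGraph.tendstoInDistribution_sum {Ω : Type*} [MeasurableSpace Ω] {P : Measure Ω}
    [IsProbabilityMeasure P] {W : Graphon} {X : ℕ → Ω → I} {G : (n : ℕ) → Ω → SimpleGraph (Fin n)}
    (hG : IsWRandomGraph W P X G) {v : I → ℝ} (hv : BddMeas v) :
    TendstoInDistribution
      (fun (n : ℕ) ω => (√(n : ℝ))⁻¹ * (∑ i ∈ Finset.range n, v (X i ω) - n * ∫ u, v u)) atTop
      (id : ℝ → ℝ) (fun _ => P) (gaussianReal 0 (Real.toNNReal (Var[v; (volume : Measure I)]))) := by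
  have hmean : ∫ ω, v (X 0 ω) ∂P = ∫ u, v u := by
    rw [← hG.uniform_X 0, integral_map (hG.measurable_X 0).aemeasurable
      hv.measurable.aestronglyMeasurable]
  have hvar : Var[fun ω => v (X 0 ω); P] = Var[v; (volume : Measure I)] := by
    rw [← hG.uniform_X 0, variance_map hv.measurable.aemeasurable (hG.measurable_X 0).aemeasurable]
    rfl
  have hident : ∀ i, IdentDistrib (fun ω => v (X i ω)) (fun ω => v (X 0 ω)) P P := fun i =>
    (⟨(hG.measurable_X i).aemeasurable, (hG.measurable_X 0).aemeasurable,
      (hG.uniform_X i).trans (hG.uniform_X 0).symm⟩ : IdentDistrib (X i) (X 0) P P).comp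
      hv.measurable
  have h := tendstoInDistribution_inv_sqrt_mul_sum_sub (P := P) (X := fun i ω => v (X i ω))
    (Y := (id : ℝ → ℝ)) (P' := gaussianReal 0 (Var[fun ω => v (X 0 ω); P]).toNNReal)
    HasLaw.id ((hv.comp (hG.measurable_X 0)).memLp P 2)
    (hG.indep_X.comp (fun _ => v) fun _ => hv.measurable) hident
  rw [hmean] at h
  simp only [hvar] at h
  exact h

theorem tendstoInDistribution_gammaN {Ω : Type*} [MeasurableSpace Ω] (P : Measure Ω) [IsProbabilityMeasure P]
    (W : Graphon) (X : ℕ → Ω → I) (G : (n : ℕ) → Ω → SimpleGraph (Fin n))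
    (hG : IsWRandomGraph W P X G)
    {d p k : ℕ} [NeZero d] (hk : 1 ≤ k)
    (F : Fin d → SimpleGraph (Fin p)) (ℓ : Fin k → Fin p) (hℓ : Function.Injective ℓ)
    (hF : SameLabelledEdges F ℓ)
    (g : (Fin d → ℝ) → ℝ) (hg : ContDiffOn ℝ 2 g (cube d)) :
    TendstoInDistribution
      (fun (n : ℕ) ω => √(n : ℝ) *
        (gammaN F ℓ g (G n ω) - gammaLim F ℓ W g))
      atTop (id : ℝ → ℝ) (fun _ => P)
      (gaussianReal 0 (Real.toNNReal (Var[uVar F ℓ W g; (volume : Measure I)]))) := by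
  have hkp : k ≤ p := by simpa using Fintype.card_le_of_injective ℓ hℓ
  have hp : 0 < p := by omega
  have huv := bddMeas_uVar W hg hℓ hF
  have hY : ∀ n : ℕ, BddMeas fun ω => √(n : ℝ) * (gammaN F ℓ g (G n ω) - gammaLim F ℓ W g) :=
    fun n => (BddMeas.const _).mul ((hG.bddMeas_graph fun H => gammaN F ℓ g H).sub
      (BddMeas.const _))
  have hS : ∀ n : ℕ, BddMeas fun ω => (√(n : ℝ))⁻¹ *
      (∑ i ∈ Finset.range n, uVar F ℓ W g (X i ω) - n * ∫ u, uVar F ℓ W g u) := fun n =>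
    (BddMeas.const _).mul ((BddMeas.sum _ fun i _ => huv.comp (hG.measurable_X i)).sub
      (BddMeas.const _))
  obtain ⟨C₁, hC₁⟩ := exists_integral_abs_gammaN_sub_le hG hℓ hF hg
  obtain ⟨C₂, hC₂⟩ := (linKernel F ℓ W hg).exists_integral_sq_average_sub_le hG hp
  -- Slutsky: the difference from the normalized i.i.d. sum need only tend to zero in measure, which
  -- follows from an `L¹` bound of order `n^(-1/2)`.
  refine tendstoInDistribution_of_tendstoInMeasure_sub _ _ (hG.tendstoInDistribution_sum huv) ?_
    fun n => (hY n).measurable.aemeasurable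
  refine tendstoInMeasure_zero_of_integral_abs_le (fun n => (hY n).sub (hS n))
    (b := fun n => (C₁ + (C₂ + 1) / 2) * (√(n : ℝ))⁻¹) ?_ ?_
  · rw [← mul_zero (C₁ + (C₂ + 1) / 2)]
    exact (tendsto_inv_atTop_zero.comp
      (Real.tendsto_sqrt_atTop.comp tendsto_natCast_atTop_atTop)).const_mul _
  filter_upwards [eventually_ge_atTop p, eventually_gt_atTop k, eventually_ge_atTop 2]
    with n hpn hkn hn
  have hn0 : (0 : ℝ) < n := by exact_mod_cast (by omega : 0 < n)
  have hsq : √(n : ℝ) * √(n : ℝ) = n := Real.mul_self_sqrt hn0.le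
  have hs0 : 0 < √(n : ℝ) := Real.sqrt_pos.2 hn0
  set A : Ω → ℝ := fun ω => (∑ γ : Fin p ↪ Fin n,
    (linKernel F ℓ W hg).eval γ (fun i => X i ω) (G n ω)) / Fintype.card (Fin p ↪ Fin n) with hA
  have hAb : BddMeas A := by
    simp only [hA, div_eq_mul_inv]
    exact (BddMeas.sum _ fun γ _ => (linKernel F ℓ W hg).bddMeas_eval hG γ).mul (BddMeas.const _)
  set R : Ω → ℝ := fun ω => A ω - gammaLim F ℓ W g -
    (∑ i : Fin n, (uVar F ℓ W g (X i ω) - ∫ u, uVar F ℓ W g u)) / n with hR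
  have hRb : BddMeas R := by
    simp only [hR, div_eq_mul_inv]
    exact (hAb.sub (BddMeas.const _)).sub ((BddMeas.sum _ fun (i : Fin n) _ =>
      (huv.comp (hG.measurable_X i)).sub (BddMeas.const _)).mul (BddMeas.const _))
  have hR2 : ∫ ω, R ω ^ 2 ∂P ≤ C₂ / (n : ℝ) ^ 2 := by
    refine le_of_eq_of_le ?_ (hC₂ n hpn hn)
    simp only [hR, sum_linKernel_proj_sub W hg hℓ hF]
    rw [integral_linKernel_mean W hg hℓ hF]
  have hQb : BddMeas fun ω => gammaN F ℓ g (G n ω) - A ω :=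
    (hG.bddMeas_graph fun H => gammaN F ℓ g H).sub hAb
  have hpt : ∀ ω, |√(n : ℝ) * (gammaN F ℓ g (G n ω) - gammaLim F ℓ W g) - (√(n : ℝ))⁻¹ *
      (∑ i ∈ Finset.range n, uVar F ℓ W g (X i ω) - n * ∫ u, uVar F ℓ W g u)| ≤
      √(n : ℝ) * (|gammaN F ℓ g (G n ω) - A ω| + (n / 2 * R ω ^ 2 + 1 / (2 * n))) := by
    intro ω
    have heq : √(n : ℝ) * (gammaN F ℓ g (G n ω) - gammaLim F ℓ W g) - (√(n : ℝ))⁻¹ *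
        (∑ i ∈ Finset.range n, uVar F ℓ W g (X i ω) - n * ∫ u, uVar F ℓ W g u) =
        √(n : ℝ) * ((gammaN F ℓ g (G n ω) - A ω) + R ω) := by
      have h1 : ∑ i : Fin n, (uVar F ℓ W g (X i ω) - ∫ u, uVar F ℓ W g u) =
          ∑ i ∈ Finset.range n, uVar F ℓ W g (X i ω) - n * ∫ u, uVar F ℓ W g u := by
        rw [Finset.sum_sub_distrib, Finset.sum_range]
        simp
      have h2 : (√(n : ℝ))⁻¹ = √(n : ℝ) / n := by
        rw [inv_eq_one_div, div_eq_div_iff hs0.ne' hn0.ne', one_mul, hsq]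
      simp only [hR]
      rw [h1, h2]
      ring
    rw [heq, abs_mul, abs_of_pos hs0]
    refine mul_le_mul_of_nonneg_left ((abs_add_le _ _).trans (add_le_add le_rfl ?_)) hs0.le
    -- The inequality `|R| ≤ n / 2 * R ^ 2 + 1 / (2 * n)` turns the `O(n^(-2))` bound on the second
    -- moment into an `O(1/n)` bound on the mean of `|R|`, in place of Cauchy–Schwarz.
    have h3 : n / 2 * R ω ^ 2 + 1 / (2 * n) - |R ω| = (n * |R ω| - 1) ^ 2 / (2 * n) := by
      rw [← sq_abs (R ω)]
      field_simp
      ring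
    have h4 : 0 ≤ (n * |R ω| - 1) ^ 2 / (2 * n) := by positivity
    linarith
  have hbd : BddMeas fun ω => |gammaN F ℓ g (G n ω) - A ω| + (n / 2 * R ω ^ 2 + 1 / (2 * n)) :=
    hQb.abs.add (((BddMeas.const _).mul hRb.sq).add (BddMeas.const _))
  refine (integral_mono_of_nonneg (.of_forall fun ω => abs_nonneg _)
    (((BddMeas.const (√(n : ℝ))).mul hbd).integrable P) (.of_forall hpt)).trans ?_
  rw [integral_const_mul, integral_add (hQb.abs.integrable P)
    ((((BddMeas.const _).mul hRb.sq).add (BddMeas.const _)).integrable P),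
    integral_add (((BddMeas.const _).mul hRb.sq).integrable P) (integrable_const _),
    integral_const_mul]
  simp only [integral_const, probReal_univ, one_smul]
  have h5 : n / 2 * ∫ ω, R ω ^ 2 ∂P ≤ n / 2 * (C₂ / (n : ℝ) ^ 2) :=
    mul_le_mul_of_nonneg_left hR2 (by positivity)
  have h6 : ∫ ω, |gammaN F ℓ g (G n ω) - A ω| ∂P ≤ C₁ / n := hC₁ n hpn hkn
  calc _ ≤ √(n : ℝ) * (C₁ / n + (n / 2 * (C₂ / (n : ℝ) ^ 2) + 1 / (2 * n))) :=
        mul_le_mul_of_nonneg_left (by linarith) hs0.le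
    _ = (C₁ + (C₂ + 1) / 2) * (√(n : ℝ) / n) := by field_simp
    _ = _ := by
        congr 1
        rw [inv_eq_one_div, div_eq_div_iff hn0.ne' hs0.ne', one_mul, hsq]

end GraphonCLT

theorem theorem3p2 {Ω : Type*} [MeasurableSpace Ω] (P : Measure Ω) [IsProbabilityMeasure P]
    (W : GraphonCLT.Graphon) (X : ℕ → Ω → I) (G : (n : ℕ) → Ω → SimpleGraph (Fin n))
    (hG : GraphonCLT.IsWRandomGraph W P X G)
    {d p k : ℕ} [NeZero d] (hk : 1 ≤ k)
    (F : Fin d → SimpleGraph (Fin p)) (ℓ : Fin k → Fin p) (hℓ : Function.Injective ℓ)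
    (hF : GraphonCLT.SameLabelledEdges F ℓ)
    (g : (Fin d → ℝ) → ℝ) (hg : ContDiffOn ℝ 2 g (GraphonCLT.cube d)) :
    TendstoInDistribution
      (fun (n : ℕ) ω => √(n : ℝ) *
        (GraphonCLT.gammaN F ℓ g (G n ω) - GraphonCLT.gammaLim F ℓ W g))
      atTop (id : ℝ → ℝ) (fun _ => P)
      (gaussianReal 0 (Real.toNNReal (Var[GraphonCLT.uVar F ℓ W g; (volume : Measure I)]))) :=
  GraphonCLT.tendstoInDistribution_gammaN P W X G hG hk F ℓ hℓ hF g hg
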